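/- **Definitions.** Let $S$ be a semigroup. For $x,y\in S$ and $z_1,z_2,\dots\in S^1$ put $\lambda_0=x$, $\rho_0=y$, $\lambda_{n+1}=\lambda_n z_{n+1}\rho_n$, $\rho_{n+1}=\rho_n z_{n+1}\lambda_n$. The semigroup $S$ is *nilpotent* (in the sense of Mal'cev) if for some $n\ge 1$ one has $\lambda_n=\rho_n$ for all $x,y\in S$ and $z_1,\dots,z_n\in S^1$. The *upper non-nilpotent graph* $\mathcal N_S$ has vertex set $S$ and an edge between $x$ and $y$ iff the subsemigroup $\langle x,y\rangle$ is not nilpotent. The empty set counts as an ideal and $S/\emptyset=S$; $S/I$ denotes the Rees quotient. $S$ is *pseudo-nilpotent* if, whenever $x,y\in S$, $w_1,\dots,w_m\in S^1$, $0\le t<m$, $\lambda_i$ and $\rho_i$ are formed with $w_1,\dots,w_i$, $\lambda_t\neq\rho_t$, $(\lambda_t,\rho_t)=(\lambda_m,\rho_m)$, and $I$ is a (possibly empty) ideal of $T=\langle x,y,w_1,\dots,w_m\rangle$ with $\lambda_m,\rho_m\notin I$, there is an edge between $\lambda_i$ and $\rho_i$ in $\mathcal N_{T/I}$ for every $0\le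 i\le m$. Let $S$ be finite and pseudo-nilpotent with principal series $S=S_1\supset S_2\supset\dots\supset S_m\supset S_{m+1}=\emptyset$ (each $S_i$ is an ideal of $S$, and no ideal of $S$ lies strictly between $S_{i+1}$ and $S_i$). Let $$F_i=\{s\in S\setminus S_i : sj\notin S_{i+1}\text{ or } js\notin S_{i+1}\text{ for some } j\in S_i\},$$ and let $S^{(i)}$ be the union of all $S_j\setminus S_{j+1}$ with $j\le i$ and $S_j\setminus S_{j+1}\subseteq F_i\cup(S_i\setminus S_{i+1})$. The set $S_i\setminus S_{i+1}$ is a *root* if $S_i/S_{i+1}$ is not nilpotent and $\mathcal N_S$ has no edge between an element of $S_i\setminus S_{i+1}$ and an element of $S_{i+1}$; then $S^{(i)}$ is called its *stem*. A set $S_k\setminus S_{k+1}$ contained in two distinct stems $S^{(i)}$ and $S^{(j)}$ is a *connection* between them. If $S_i\setminus S_{i+1}$ is a root, it is identified with a Rees matrix semigroup $\mathcal M(G,I,\Lambda;P)$ over a group $G$, with elements $(g;c,d)$. The *pseudo-nilpotent homomorphism* $\Phi_i:(S/S_{i+1})^0\to(I\times\Lambda)^0$ maps $a\in F_i\cup(S_i\setminus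 S_{i+1})$ to the unique pair $(c,d)\in I\times\Lambda$ such that in $\mathcal N_{S/S_{i+1}}$ there is no edge between $a$ and $(g;c,d)$ for any $g\in G$, while there is an edge between $a$ and every $(g;c',d')$ with $(c',d')\ne(c,d)$; all other elements are mapped to the zero $\theta$. Its fibres are the *pseudo-nilpotent classes* of $\Phi_i$. The finite pseudo-nilpotent semigroup $S$ is *strong pseudo-nilpotent* if * (H1) every connection $S_k\setminus S_{k+1}$ between two stems $S^{(i)}$ and $S^{(j)}$ intersects two different pseudo-nilpotent classes of $\Phi_i$ and also two different pseudo-nilpotent classes of $\Phi_j$; and * (H2) whenever $i<j$ and $\mathcal N_S$ has an edge between some element of $S_i\setminus S_{i+1}$ and some element of $S_j\setminus S_{j+1}$, then $S_i\setminus S_{i+1}\subseteq F_j$. **Corollary.** Let $S$ be a strong pseudo-nilpotent finite semigroup and let $K$ be the set of isolated vertices of $\mathcal N_S$. Two elements $x$ and $y$ of $S\setminus K$ lie in the same connected component of $\mathcal N_S$ if and only if there exists an element $z\in S$ such that $xz\notin K$ and $zy\notin K$. -/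

import Mathlib

namespace PseudoNilpotent

universe u v

section Malcev

variable {S : Type u} [Semigroup S]

/-- The product `a w b` in `S`, where `w ∈ S¹`; the adjoined identity is dropped. -/
def sandwich (a : S) (w : WithOne S) (b : S) : S :=
  WithOne.recOneCoe (motive := fun _ => S) (a * b) (fun c => a * c * b) w

/-- The pair `(λₙ, ρₙ)` of the sequences `λ₀ = x`, `ρ₀ = y`,
`λₙ₊₁ = λₙ zₙ₊₁ ρₙ`, `ρₙ₊₁ = ρₙ zₙ₊₁ λₙ`. Here `w n` is the parameter `zₙ₊₁`. -/
def malcevPair (x y : S) (w : ℕ → WithOne S) : ℕ → S × S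
  | 0 => (x, y)
  | n + 1 =>
    (sandwich (malcevPair x y w n).1 (w n) (malcevPair x y w n).2,
      sandwich (malcevPair x y w n).2 (w n) (malcevPair x y w n).1)

/-- `λₙ(x, y, z₁, …, zₙ)`. -/
def malcevL (x y : S) (w : ℕ → WithOne S) (n : ℕ) : S := (malcevPair x y w n).1

/-- `ρₙ(x, y, z₁, …, zₙ)`. -/
def malcevR (x y : S) (w : ℕ → WithOne S) (n : ℕ) : S := (malcevPair x y w n).2

variable (S) in
/-- Nilpotency of a semigroup in the sense of Mal'cev. -/
def MalcevNilpotent : Prop :=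
  ∃ n : ℕ, 0 < n ∧ ∀ (a b : S) (w : ℕ → WithOne S), malcevL a b w n = malcevR a b w n

theorem malcevNilpotent_of_comm (h : ∀ a b : S, a * b = b * a) : MalcevNilpotent S := by
  refine ⟨1, one_pos, fun a b w => ?_⟩
  simp only [malcevL, malcevR, malcevPair]
  induction w 0 using WithOne.recOneCoe with
  | one => exact h a b
  | coe c =>
    change a * c * b = b * c * a
    rw [h (a * c) b, h a c, mul_assoc]

theorem malcevNilpotent_closure_self (x : S) :
    MalcevNilpotent (Subsemigroup.closure ({x, x} : Set S)) := by
  apply malcevNilpotent_of_comm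
  rintro ⟨a, ha⟩ ⟨b, hb⟩
  apply Subtype.ext
  change a * b = b * a
  have hx : ∀ c ∈ Subsemigroup.closure ({x, x} : Set S), c * x = x * c := by
    intro c hc
    induction hc using Subsemigroup.closure_induction with
    | mem c hc => simp only [Set.mem_insert_iff, Set.mem_singleton_iff, or_self] at hc; rw [hc]
    | mul c d _ _ h1 h2 => rw [mul_assoc, h2, ← mul_assoc, h1, mul_assoc]
  induction hb using Subsemigroup.closure_induction with
  | mem b hb =>
    simp only [Set.mem_insert_iff, Set.mem_singleton_iff, or_self] at hb
    rw [hb, hx a ha]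
  | mul c d _ _ h1 h2 => rw [← mul_assoc, h1, mul_assoc, h2, mul_assoc]

variable (S) in
/-- The upper non-nilpotent graph `N_S`: there is an edge between `x` and `y` iff the
subsemigroup generated by `x` and `y` is not nilpotent. -/
def upperGraph : SimpleGraph S where
  Adj x y := ¬ MalcevNilpotent (Subsemigroup.closure ({x, y} : Set S))
  symm := ⟨fun x y h => by rwa [Set.pair_comm y x]⟩
  loopless := ⟨fun x h => h (malcevNilpotent_closure_self x)⟩

variable (S) in
/-- The set `K` of isolated vertices of `N_S`. -/
def isolatedSet : Set S := {x | (upperGraph S).IsIsolated x}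

end Malcev

section Ideals

variable {S : Type u} [Semigroup S]

/-- Two-sided ideals; the empty set is allowed. -/
def IsIdeal (A : Set S) : Prop := ∀ a ∈ A, ∀ s : S, s * a ∈ A ∧ a * s ∈ A

/-- The Rees congruence of an ideal: it collapses the ideal to a point. -/
def reesCon (A : Set S) (hA : IsIdeal A) : Con S where
  r a b := a = b ∨ (a ∈ A ∧ b ∈ A)
  iseqv :=
    { refl := fun _ => Or.inl rfl
      symm := by
        rintro a b (h | ⟨h1, h2⟩)
        · exact Or.inl h.symm
        · exact Or.inr ⟨h2, h1⟩
      trans := by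
        rintro a b c (rfl | ⟨h1, h2⟩) h
        · exact h
        · rcases h with rfl | ⟨_, h4⟩
          · exact Or.inr ⟨h1, h2⟩
          · exact Or.inr ⟨h1, h4⟩ }
  mul' := by
    rintro a b c d (rfl | ⟨h1, h2⟩) (rfl | ⟨h3, h4⟩)
    · exact Or.inl rfl
    · exact Or.inr ⟨(hA _ h3 a).1, (hA _ h4 a).1⟩
    · exact Or.inr ⟨(hA _ h1 c).2, (hA _ h2 c).2⟩
    · exact Or.inr ⟨(hA _ h1 c).2, (hA _ h2 d).2⟩

/-- The Rees quotient `S / A` (with `S / ∅ = S`). -/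
abbrev ReesQuotient (A : Set S) (hA : IsIdeal A) : Type u := (reesCon A hA).Quotient

/-- The class of `s` in `S / A`. -/
abbrev reesMk (A : Set S) (hA : IsIdeal A) (s : S) : ReesQuotient A hA :=
  (reesCon A hA).toQuotient s

/-- An ideal regarded as a subsemigroup. -/
def IsIdeal.toSubsemigroup {A : Set S} (hA : IsIdeal A) : Subsemigroup S where
  carrier := A
  mul_mem' := fun {a _} _ hb => (hA _ hb a).1

theorem IsIdeal.preimage {A : Set S} (hA : IsIdeal A) (T : Subsemigroup S) :
    IsIdeal {t : T | (t : S) ∈ A} :=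
  fun a ha s => hA a ha s

end Ideals

section PseudoNilpotent

variable {S : Type u} [Semigroup S]

/-- The subsemigroup `⟨x, y, w₁, …, wₘ⟩` of `S`; a parameter equal to the adjoined identity
contributes no generator. -/
def malcevSpan (x y : S) (w : ℕ → WithOne S) (m : ℕ) : Subsemigroup S :=
  Subsemigroup.closure ({x, y} ∪ {c : S | ∃ i < m, w i = (c : WithOne S)})

theorem malcevPair_mem (x y : S) (w : ℕ → WithOne S) (m : ℕ) :
    ∀ i ≤ m, (malcevPair x y w i).1 ∈ malcevSpan x y w m ∧
      (malcevPair x y w i).2 ∈ malcevSpan x y w m := by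
  intro i
  induction i with
  | zero =>
    intro _
    exact ⟨Subsemigroup.subset_closure (Or.inl (Or.inl rfl)),
      Subsemigroup.subset_closure (Or.inl (Or.inr rfl))⟩
  | succ i ih =>
    intro hi
    obtain ⟨h1, h2⟩ := ih (by omega)
    have key : ∀ v : WithOne S, w i = v → ∀ a b : S, a ∈ malcevSpan x y w m →
        b ∈ malcevSpan x y w m → sandwich a v b ∈ malcevSpan x y w m := by
      intro v hv a b ha hb
      induction v using WithOne.recOneCoe with
      | one => exact mul_mem ha hb
      | coe c =>
        have hc : c ∈ malcevSpan x y w m :=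
          Subsemigroup.subset_closure (Or.inr ⟨i, by omega, hv⟩)
        exact mul_mem (mul_mem ha hc) hb
    exact ⟨key _ rfl _ _ h1 h2, key _ rfl _ _ h2 h1⟩

/-- `λᵢ` as an element of `⟨x, y, w₁, …, wₘ⟩`, for `i ≤ m`. -/
def spanL (x y : S) (w : ℕ → WithOne S) (m i : ℕ) (hi : i ≤ m) : malcevSpan x y w m :=
  ⟨malcevL x y w i, (malcevPair_mem x y w m i hi).1⟩

/-- `ρᵢ` as an element of `⟨x, y, w₁, …, wₘ⟩`, for `i ≤ m`. -/
def spanR (x y : S) (w : ℕ → WithOne S) (m i : ℕ) (hi : i ≤ m) : malcevSpan x y w m :=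
  ⟨malcevR x y w i, (malcevPair_mem x y w m i hi).2⟩

variable (S) in
/-- Pseudo-nilpotent semigroups. -/
def IsPseudoNilpotent : Prop :=
  ∀ (x y : S) (w : ℕ → WithOne S) (t m : ℕ), t < m →
    malcevL x y w t ≠ malcevR x y w t →
    (malcevL x y w t, malcevR x y w t) = (malcevL x y w m, malcevR x y w m) →
    ∀ (A : Set (malcevSpan x y w m)) (hA : IsIdeal A),
      spanL x y w m m le_rfl ∉ A → spanR x y w m m le_rfl ∉ A →
      ∀ (i : ℕ) (hi : i ≤ m),
        (upperGraph (ReesQuotient A hA)).Adj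
          (reesMk A hA (spanL x y w m i hi)) (reesMk A hA (spanR x y w m i hi))

end PseudoNilpotent

/-- A principal series `S = S₁ ⊃ S₂ ⊃ ⋯ ⊃ Sₘ ⊃ Sₘ₊₁ = ∅`. Indices start at `0` here:
`ideal 0 = S₁` and `ideal (Fin.last length) = Sₘ₊₁`. -/
structure PrincipalSeries (S : Type u) [Semigroup S] where
  length : ℕ
  ideal : Fin (length + 1) → Set S
  isIdeal : ∀ k, IsIdeal (ideal k)
  first_eq : ideal 0 = Set.univ
  last_eq : ideal (Fin.last length) = ∅
  strict : ∀ i : Fin length, ideal i.succ ⊂ ideal i.castSucc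
  no_between : ∀ (i : Fin length) (A : Set S), IsIdeal A →
    ideal i.succ ⊆ A → A ⊆ ideal i.castSucc → A = ideal i.succ ∨ A = ideal i.castSucc

/-- Elements of the Rees matrix semigroup `M(G, I, Λ; P)` over a group `G` with sandwich
matrix `P : Λ × I → G`; `⟨g, i, l⟩` stands for `(g; i, λ)`. -/
@[ext]
structure ReesMatrix {G I L : Type v} (P : L → I → G) where
  g : G
  i : I
  l : L

instance {G I L : Type v} [Group G] (P : L → I → G) : Mul (ReesMatrix P) :=
  ⟨fun a b => ⟨a.g * P a.l b.i * b.g, a.i, b.l⟩⟩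

namespace PrincipalSeries

variable {S : Type u} [Semigroup S] (Q : PrincipalSeries S)

/-- The ideal `Sᵢ`. -/
def upper (i : Fin Q.length) : Set S := Q.ideal i.castSucc

/-- The ideal `Sᵢ₊₁`. -/
def lower (i : Fin Q.length) : Set S := Q.ideal i.succ

theorem upper_isIdeal (i : Fin Q.length) : IsIdeal (Q.upper i) := Q.isIdeal _

theorem lower_isIdeal (i : Fin Q.length) : IsIdeal (Q.lower i) := Q.isIdeal _

/-- The set `Sᵢ \ Sᵢ₊₁`. -/
def layer (i : Fin Q.length) : Set S := Q.upper i \ Q.lower i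

/-- The principal factor `Sᵢ / Sᵢ₊₁`. -/
abbrev Factor (i : Fin Q.length) : Type u :=
  ReesQuotient {t : (Q.upper_isIdeal i).toSubsemigroup | (t : S) ∈ Q.lower i}
    ((Q.lower_isIdeal i).preimage _)

/-- The quotient `S / Sᵢ₊₁`. -/
abbrev QuotAt (i : Fin Q.length) : Type u := ReesQuotient (Q.lower i) (Q.lower_isIdeal i)

/-- The class of `s` in `S / Sᵢ₊₁`. -/
abbrev cls (i : Fin Q.length) (s : S) : Q.QuotAt i := reesMk (Q.lower i) (Q.lower_isIdeal i) s

/-- `Sᵢ \ Sᵢ₊₁` is a root: the factor `Sᵢ / Sᵢ₊₁` is not nilpotent, and `N_S` has no edge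
between an element of `Sᵢ \ Sᵢ₊₁` and an element of `Sᵢ₊₁`. -/
def IsRoot (i : Fin Q.length) : Prop :=
  ¬ MalcevNilpotent (Q.Factor i) ∧
    ∀ a ∈ Q.layer i, ∀ b ∈ Q.lower i, ¬ (upperGraph S).Adj a b

/-- The set `F_J` for the ideal `J = Sᵢ / Sᵢ₊₁` of the semigroup with zero `(S / Sᵢ₊₁)⁰`. Nonzero
elements of `(S / Sᵢ₊₁)⁰` are identified with elements of `S \ Sᵢ₊₁`, so a product is nonzero
iff it lies outside `Sᵢ₊₁`. -/
def annFree (i : Fin Q.length) : Set S :=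
  {s | s ∉ Q.upper i ∧ ∃ j ∈ Q.upper i, s * j ∉ Q.lower i ∨ j * s ∉ Q.lower i}

/-- The set `S⁽ⁱ⁾`, the union of those `Sⱼ \ Sⱼ₊₁` with `j ≤ i` that are contained in
`F_J ∪ (Sᵢ \ Sᵢ₊₁)`, where `J = Sᵢ / Sᵢ₊₁`. It is called a stem when `Sᵢ \ Sᵢ₊₁` is a root. -/
def stem (i : Fin Q.length) : Set S :=
  ⋃ j ∈ {j : Fin Q.length | j ≤ i ∧ Q.layer j ⊆ Q.annFree i ∪ Q.layer i}, Q.layer j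

/-- `Sₖ \ Sₖ₊₁` is a connection between the two distinct stems `S⁽ⁱ⁾` and `S⁽ʲ⁾`. -/
def IsConnection (k i j : Fin Q.length) : Prop :=
  Q.IsRoot i ∧ Q.IsRoot j ∧ Q.stem i ≠ Q.stem j ∧ Q.layer k ⊆ Q.stem i ∩ Q.stem j

/-- `Φ` is the pseudo-nilpotent homomorphism `(S / Sᵢ₊₁)⁰ → (I × Λ)⁰` attached to an
identification `e` of `Sᵢ \ Sᵢ₊₁` with `M(G, I, Λ; P)`. It is written as a function on `S`, via
`S → (S / Sᵢ₊₁)⁰`. An element `a` of `F_J ∪ (Sᵢ \ Sᵢ₊₁)` goes to the pair `(c, d)` for which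
`N_{S / Sᵢ₊₁}` has no edge between `a` and any `(g; c, d)`, but has an edge between `a` and every
`(g; c', d')` with `(c', d') ≠ (c, d)`; all other elements go to zero. -/
def IsPNHom (i : Fin Q.length) {G I L : Type u} [Group G] {P : L → I → G}
    (e : ReesMatrix P →ₙ* S) (Φ : S → WithZero (I × L)) : Prop :=
  (∀ a ∈ Q.annFree i ∪ Q.layer i, ∃ (c : I) (d : L), Φ a = ((c, d) : I × L) ∧
    (∀ g : G, ¬ (upperGraph (Q.QuotAt i)).Adj (Q.cls i a) (Q.cls i (e ⟨g, c, d⟩))) ∧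
    (∀ (g : G) (c' : I) (d' : L), (c', d') ≠ (c, d) →
      (upperGraph (Q.QuotAt i)).Adj (Q.cls i a) (Q.cls i (e ⟨g, c', d'⟩)))) ∧
  (∀ a, a ∉ Q.annFree i ∪ Q.layer i → Φ a = 0)

/-- `Sₖ \ Sₖ₊₁` intersects two different pseudo-nilpotent classes (the fibres of the
pseudo-nilpotent homomorphism `Φ` with domain `(S / Sᵢ₊₁)⁰`), for whatever Rees matrix coordinates
on `Sᵢ \ Sᵢ₊₁` are used. -/
def MeetsTwoClasses (k i : Fin Q.length) : Prop :=
  ∀ (G I L : Type u) [Group G] (P : L → I → G) (e : ReesMatrix P →ₙ* S),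
    Function.Injective e → Set.range e = Q.layer i →
    ∀ Φ : S → WithZero (I × L), Q.IsPNHom i e Φ →
      ∃ a ∈ Q.layer k, ∃ b ∈ Q.layer k, Φ a ≠ Φ b

/-- Every connection intersects two different pseudo-nilpotent classes of each of the two
pseudo-nilpotent homomorphisms of the stems it connects. -/
def H1 : Prop :=
  ∀ k i j : Fin Q.length, Q.IsConnection k i j → Q.MeetsTwoClasses k i ∧ Q.MeetsTwoClasses k j

/-- If `i < j` and `N_S` has an edge between `Sᵢ \ Sᵢ₊₁` and `Sⱼ \ Sⱼ₊₁`, then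
`Sᵢ \ Sᵢ₊₁ ⊆ F_J` for `J = Sⱼ / Sⱼ₊₁`. -/
def H2 : Prop :=
  ∀ i j : Fin Q.length, i < j →
    (∃ a ∈ Q.layer i, ∃ b ∈ Q.layer j, (upperGraph S).Adj a b) → Q.layer i ⊆ Q.annFree j

end PrincipalSeries

/-- Strong pseudo-nilpotent semigroups: pseudo-nilpotent semigroups with a principal series
satisfying both conditions. -/
def IsStrongPseudoNilpotent (S : Type u) [Semigroup S] : Prop :=
  IsPseudoNilpotent S ∧ ∃ Q : PrincipalSeries S, Q.H1 ∧ Q.H2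

end PseudoNilpotent

/-! Everything is reduced to Green's relations in the finite monoid `WithOne S`. Non-nilpotence of a
finite semigroup means that some nonempty set of pairs of distinct elements is closed under suitable
Mal'cev steps (`Inv`, `NonNil`). Pseudo-nilpotence then says that such a set, wherever its
parameters lie, can be replaced by one inside the submonoid generated by any of its pairs
(`isPN_withOne`).

This has strong consequences. A J-class that contains a pair of an invariant set is closed under
multiplication (`IsPN.isFull_of_inv`), and the pair cannot be H-related (`IsPN.not_hEq`). Moreover
every s ≠ 1 above a full J-class maps it, on the left, into one R-class and, on the right, into one
L-class (`IsPN.rEq_mul`, `IsPN.lEq_mul`). Hence x and y are adjacent iff some big J-class (full,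
with at least two H-classes) lies below both and they determine different H-classes of it
(`IsPN.adj_iff`). So x is non-isolated iff it lies above a big J-class, and any two elements above a
common big J-class are connected.

If xz and zy are non-isolated, then x, z lie above a common big class, and so do z, y; this gives
one direction. For the other, it suffices to find t with x, t above one big class and t, y above
another, since fullness puts the products xt and ty above these classes again. Such a t comes from
induction along a walk. The inductive step is `exists_jLE_of_isMinBig`: minimal big classes are
roots and their stems are the up-sets above them. (H1) supplies, in the layer joining two stems, an
element adjacent to a given one, and (H2) turns that edge into comparability with the next class. -/

namespace PseudoNilpotent

/-! ### Green's relations and stability in finite monoids -/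

section Green

variable {M : Type*} [Monoid M]

/-- `x ∈ M s M`. -/
def JLE (x s : M) : Prop := ∃ u v, x = u * s * v

/-- Green's relation `R`. -/
def REq (a b : M) : Prop := (∃ u, a = b * u) ∧ ∃ v, b = a * v

/-- Green's relation `L`. -/
def LEq (a b : M) : Prop := (∃ u, a = u * b) ∧ ∃ v, b = v * a

/-- Green's relation `J`. -/
def JEq (a b : M) : Prop := JLE a b ∧ JLE b a

theorem JLE.refl (a : M) : JLE a a := ⟨1, 1, by simp⟩

theorem JLE.trans {a b c : M} (h : JLE a b) (h' : JLE b c) : JLE a c := by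
  obtain ⟨u, v, rfl⟩ := h
  obtain ⟨u', v', rfl⟩ := h'
  exact ⟨u * u', v' * v, by simp only [mul_assoc]⟩

theorem JLE.mul_left (a b : M) : JLE (a * b) b := ⟨a, 1, by simp⟩

theorem JLE.mul_right (a b : M) : JLE (a * b) a := ⟨1, b, by simp⟩

theorem JLE.of_mul_left {x a b : M} (h : JLE x (a * b)) : JLE x a := h.trans (.mul_right a b)

theorem JLE.of_mul_right {x a b : M} (h : JLE x (a * b)) : JLE x b := h.trans (.mul_left a b)

theorem JLE.one (a : M) : JLE a 1 := ⟨a, 1, by simp⟩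

theorem JEq.refl (a : M) : JEq a a := ⟨.refl a, .refl a⟩

theorem JEq.symm {a b : M} (h : JEq a b) : JEq b a := ⟨h.2, h.1⟩

theorem JEq.trans {a b c : M} (h : JEq a b) (h' : JEq b c) : JEq a c :=
  ⟨h.1.trans h'.1, h'.2.trans h.2⟩

theorem REq.refl (a : M) : REq a a := ⟨⟨1, by simp⟩, 1, by simp⟩

theorem REq.symm {a b : M} (h : REq a b) : REq b a := ⟨h.2, h.1⟩

theorem REq.trans {a b c : M} (h : REq a b) (h' : REq b c) : REq a c := by
  obtain ⟨⟨u, hu⟩, v, hv⟩ := h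
  obtain ⟨⟨u', hu'⟩, v', hv'⟩ := h'
  exact ⟨⟨u' * u, by rw [hu, hu', mul_assoc]⟩, v * v', by rw [hv', hv, mul_assoc]⟩

theorem REq.mul_left {a b : M} (h : REq a b) (c : M) : REq (c * a) (c * b) := by
  obtain ⟨⟨u, hu⟩, v, hv⟩ := h
  exact ⟨⟨u, by rw [mul_assoc, ← hu]⟩, v, by rw [mul_assoc, ← hv]⟩

theorem REq.jEq {a b : M} (h : REq a b) : JEq a b := by
  obtain ⟨⟨u, hu⟩, v, hv⟩ := h
  exact ⟨⟨1, u, by simpa using hu⟩, 1, v, by simpa using hv⟩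

theorem LEq.refl (a : M) : LEq a a := ⟨⟨1, by simp⟩, 1, by simp⟩

theorem LEq.symm {a b : M} (h : LEq a b) : LEq b a := ⟨h.2, h.1⟩

theorem LEq.trans {a b c : M} (h : LEq a b) (h' : LEq b c) : LEq a c := by
  obtain ⟨⟨u, hu⟩, v, hv⟩ := h
  obtain ⟨⟨u', hu'⟩, v', hv'⟩ := h'
  exact ⟨⟨u * u', by rw [hu, hu', mul_assoc]⟩, v' * v, by rw [hv', hv, mul_assoc]⟩

theorem LEq.mul_right {a b : M} (h : LEq a b) (c : M) : LEq (a * c) (b * c) := by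
  obtain ⟨⟨u, hu⟩, v, hv⟩ := h
  exact ⟨⟨u, by rw [← mul_assoc, ← hu]⟩, v, by rw [← mul_assoc, ← hv]⟩

theorem LEq.jEq {a b : M} (h : LEq a b) : JEq a b := by
  obtain ⟨⟨u, hu⟩, v, hv⟩ := h
  exact ⟨⟨u, 1, by simpa using hu⟩, v, 1, by simpa using hv⟩

theorem JEq.mul_of_right {z a s : M} (ha : JEq z a) (h : JLE z (a * s)) : JEq z (a * s) :=
  ⟨h, (JLE.mul_right a s).trans ha.2⟩

theorem JEq.mul_of_left {z a s : M} (ha : JEq z a) (h : JLE z (s * a)) : JEq z (s * a) :=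
  ⟨h, (JLE.mul_left s a).trans ha.2⟩

theorem exists_pow_idempotent [Finite M] (s : M) : ∃ n : ℕ, 0 < n ∧ s ^ n * s ^ n = s ^ n := by
  obtain ⟨a, b, hab, h⟩ := Finite.exists_ne_map_eq_of_infinite (fun n : ℕ => s ^ n)
  wlog hlt : a < b generalizing a b
  · exact this b a hab.symm h.symm (by omega)
  obtain ⟨p, rfl⟩ := Nat.exists_eq_add_of_lt hlt
  have h1 : ∀ n, a ≤ n → s ^ (n + (p + 1)) = s ^ n := by
    intro n hn
    obtain ⟨d, rfl⟩ := Nat.exists_eq_add_of_le hn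
    have h' : s ^ a = s ^ (a + p + 1) := h
    rw [show a + d + (p + 1) = (a + p + 1) + d by ring, pow_add, ← h', ← pow_add]
  have h2 : ∀ k n, a ≤ n → s ^ (n + k * (p + 1)) = s ^ n := by
    intro k
    induction k with
    | zero => simp
    | succ k ih =>
      intro n hn
      rw [show n + (k + 1) * (p + 1) = (n + k * (p + 1)) + (p + 1) by ring, h1 _ (by omega), ih n hn]
  -- This exponent is a multiple of the period p + 1 and at least the index a, so doubling it only
  -- adds whole periods.
  refine ⟨(a + 1) * (p + 1), by positivity, ?_⟩
  rw [← pow_add, h2 (a + 1) _ (by nlinarith)]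

theorem eq_pow_mul_mul_pow {x u v : M} (h : x = u * x * v) (n : ℕ) : x = u ^ n * x * v ^ n := by
  induction n with
  | zero => simp
  | succ n ih =>
    calc x = u ^ n * (u * x * v) * v ^ n := by rw [← h]; exact ih
      _ = u ^ (n + 1) * x * v ^ (n + 1) := by rw [pow_succ u, pow_succ' v]; simp only [mul_assoc]

variable [Finite M]

/-- Stability: iterating x = u x (sv) up to an idempotent power of sv shows that this power fixes x
on the right, so x is a right multiple of xs. -/
theorem REq.of_jLE {x s : M} (h : JLE x (x * s)) : REq x (x * s) := by
  obtain ⟨u, v, h⟩ := h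
  obtain ⟨n, hn, he⟩ := exists_pow_idempotent (s * v)
  have h1 : x = u * x * (s * v) := by simpa only [mul_assoc] using h
  have h2 := eq_pow_mul_mul_pow h1 n
  have h3 : x * (s * v) ^ n = x := by
    conv_lhs => rw [h2]
    rw [mul_assoc, he, ← h2]
  refine ⟨⟨v * (s * v) ^ (n - 1), ?_⟩, s, rfl⟩
  conv_lhs => rw [← h3, ← Nat.sub_add_cancel hn, pow_succ']
  simp only [mul_assoc]

theorem LEq.of_jLE {x s : M} (h : JLE x (s * x)) : LEq x (s * x) := by
  obtain ⟨u, v, h⟩ := h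
  obtain ⟨n, hn, he⟩ := exists_pow_idempotent (u * s)
  have h1 : x = (u * s) * x * v := by simpa only [mul_assoc] using h
  have h2 := eq_pow_mul_mul_pow h1 n
  have h3 : (u * s) ^ n * x = x := by
    conv_lhs => rw [h2]
    rw [← mul_assoc, ← mul_assoc, he, ← h2]
  refine ⟨⟨(u * s) ^ (n - 1) * u, ?_⟩, s, rfl⟩
  conv_lhs => rw [← h3, ← Nat.sub_add_cancel hn, pow_succ]
  simp only [mul_assoc]

theorem JEq.rEq_mul {z a s : M} (ha : JEq z a) (h : JLE z (a * s)) : REq a (a * s) :=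
  .of_jLE (ha.2.trans h)

theorem JEq.lEq_mul {z a s : M} (ha : JEq z a) (h : JLE z (s * a)) : LEq a (s * a) :=
  .of_jLE (ha.2.trans h)

/-- If `ab` and `bc` stay in the `J`-class of `b`, then so does `abc`. -/
theorem JEq.mul_mul {z a b c : M} (hb : JEq z b) (hab : JLE z (a * b)) (hbc : JLE z (b * c)) :
    JEq z (a * b * c) := by
  have h1 : LEq b (a * b) := hb.lEq_mul hab
  have h2 := h1.mul_right c
  exact (hb.mul_of_right hbc).trans h2.jEq

/-- This is D = J for finite monoids: if b = u a v, then ua is the middle element. -/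
theorem REq.exists_mid {z a b : M} (ha : JEq z a) (hb : JEq z b) : ∃ c, LEq a c ∧ REq b c := by
  obtain ⟨u, v, h⟩ := hb.symm.trans ha |>.1
  have h1 : JLE z (u * a) := hb.1.trans ⟨1, v, by simpa using h⟩
  refine ⟨u * a, ha.lEq_mul h1, ?_⟩
  have := (ha.mul_of_left h1).rEq_mul (s := v) (by rw [← h]; exact hb.1)
  rw [← h] at this
  exact this.symm

end Green

/-! ### Left–right duality -/

section Dual

open MulOpposite

variable {M : Type*} [Monoid M]

theorem jLE_op {x s : M} : JLE (op x) (op s) ↔ JLE x s := by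
  constructor
  · rintro ⟨u, v, h⟩
    exact ⟨unop v, unop u, by simpa [mul_assoc] using congrArg unop h⟩
  · rintro ⟨u, v, rfl⟩
    exact ⟨op v, op u, by simp [mul_assoc]⟩

theorem jEq_op {x s : M} : JEq (op x) (op s) ↔ JEq x s := and_congr jLE_op jLE_op

theorem rEq_op {a b : M} : REq (op a) (op b) ↔ LEq a b := by
  constructor
  · rintro ⟨⟨u, hu⟩, v, hv⟩
    exact ⟨⟨unop u, by simpa using congrArg unop hu⟩, unop v, by simpa using congrArg unop hv⟩
  · rintro ⟨⟨u, hu⟩, v, hv⟩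
    exact ⟨⟨op u, by rw [hu]; simp⟩, op v, by rw [hv]; simp⟩

theorem lEq_op {a b : M} : LEq (op a) (op b) ↔ REq a b := by
  constructor
  · rintro ⟨⟨u, hu⟩, v, hv⟩
    exact ⟨⟨unop u, by simpa using congrArg unop hu⟩, unop v, by simpa using congrArg unop hv⟩
  · rintro ⟨⟨u, hu⟩, v, hv⟩
    exact ⟨⟨op u, by rw [hu]; simp⟩, op v, by rw [hv]; simp⟩

end Dual

/-! ### Invariant sets of pairs and the monoid form of pseudo-nilpotence -/

section Inv

variable {M : Type*} [Monoid M]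

/-- A set of pairs of distinct elements of `A` in which every pair `(a, b)` has a successor
`(a w b, b w a)` with `w ∈ U`. -/
structure Inv (U A : Set M) (B : Set (M × M)) : Prop where
  ne : ∀ p ∈ B, p.1 ≠ p.2
  left : ∀ p ∈ B, p.1 ∈ A
  right : ∀ p ∈ B, p.2 ∈ A
  step : ∀ p ∈ B, ∃ w ∈ U, (p.1 * w * p.2, p.2 * w * p.1) ∈ B

/-- The submonoid generated by `a` and `b` contains an invariant set of pairs in `A`. -/
def NonNil (A : Set M) (a b : M) : Prop :=
  ∃ B : Set (M × M), B.Nonempty ∧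
    (∀ p ∈ B, p.1 ∈ Submonoid.closure {a, b} ∧ p.2 ∈ Submonoid.closure {a, b}) ∧
    Inv (Submonoid.closure {a, b} : Set M) A B

variable (M) in
/-- The properties of `S¹` that a finite pseudo-nilpotent semigroup `S` provides. -/
structure IsPN : Prop where
  unit : ∀ a b : M, a * b = 1 → a = 1
  nonNil : ∀ (z a b : M) (B : Set (M × M)), a ≠ 1 → b ≠ 1 → Inv Set.univ {s | JLE z s} B →
    (a, b) ∈ B → NonNil {s | JLE z s} a b

/-- An anti-homomorphism turns a w b into f(b) f(w) f(a), which swaps the two coordinates at each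
step; hence the image is taken with both orders of every pair. -/
theorem Inv.antiHom {N : Type*} [Monoid N] (f : M → N) (hf : Function.Injective f)
    (hmul : ∀ a b, f (a * b) = f b * f a) {U A : Set M} {U' A' : Set N}
    (hU : ∀ a ∈ U, f a ∈ U') (hA : ∀ a ∈ A, f a ∈ A') {B : Set (M × M)} (h : Inv U A B) :
    Inv U' A' {q | ∃ p ∈ B, q = (f p.1, f p.2) ∨ q = (f p.2, f p.1)} where
  ne := by
    rintro q ⟨p, hp, rfl | rfl⟩
    · exact fun e => h.ne p hp (hf e)
    · exact fun e => h.ne p hp (hf e.symm)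
  left := by
    rintro q ⟨p, hp, rfl | rfl⟩
    · exact hA _ (h.left p hp)
    · exact hA _ (h.right p hp)
  right := by
    rintro q ⟨p, hp, rfl | rfl⟩
    · exact hA _ (h.right p hp)
    · exact hA _ (h.left p hp)
  step := by
    rintro q ⟨p, hp, rfl | rfl⟩ <;> obtain ⟨w, hw, hs⟩ := h.step p hp
    · exact ⟨f w, hU w hw, _, hs, Or.inr (by simp [hmul, mul_assoc])⟩
    · exact ⟨f w, hU w hw, _, hs, Or.inl (by simp [hmul, mul_assoc])⟩

theorem Inv.mono {U U' A A' : Set M} {B : Set (M × M)} (h : Inv U A B) (hU : U ⊆ U')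
    (hA : A ⊆ A') : Inv U' A' B where
  ne := h.ne
  left p hp := hA (h.left p hp)
  right p hp := hA (h.right p hp)
  step p hp := (h.step p hp).imp fun _ hw => ⟨hU hw.1, hw.2⟩

theorem NonNil.mono {A A' : Set M} {a b : M} (h : NonNil A a b) (hA : A ⊆ A') : NonNil A' a b := by
  obtain ⟨B, h1, h2, h3⟩ := h
  exact ⟨B, h1, h2, h3.mono subset_rfl hA⟩

theorem NonNil.antiHom {N : Type*} [Monoid N] (f : M → N) (hf : Function.Injective f)
    (hone : f 1 = 1) (hmul : ∀ a b, f (a * b) = f b * f a) {A : Set M} {A' : Set N} {a b : M}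
    (h : NonNil A a b) (hA : ∀ a ∈ A, f a ∈ A') : NonNil A' (f a) (f b) := by
  have key : ∀ c ∈ Submonoid.closure {a, b}, f c ∈ Submonoid.closure {f a, f b} := by
    intro c hc
    induction hc using Submonoid.closure_induction with
    | mem x hx =>
      apply Submonoid.subset_closure
      rcases hx with rfl | hx
      · exact Or.inl rfl
      · rw [Set.mem_singleton_iff] at hx
        exact Or.inr (by rw [hx]; rfl)
    | one => exact hone ▸ one_mem _
    | mul x y _ _ hx hy => exact hmul x y ▸ mul_mem hy hx
  obtain ⟨B, ⟨p, hp⟩, h2, h3⟩ := h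
  have h4 := h3.antiHom (U' := (Submonoid.closure {f a, f b} : Set N)) f hf hmul key hA
  refine ⟨_, ?_, ?_, h4⟩
  · exact ⟨(f p.1, f p.2), p, hp, Or.inl rfl⟩
  rintro q ⟨p, hp, rfl | rfl⟩
  · exact ⟨key _ (h2 p hp).1, key _ (h2 p hp).2⟩
  · exact ⟨key _ (h2 p hp).2, key _ (h2 p hp).1⟩

theorem IsPN.right_unit (h : IsPN M) {a b : M} (hab : a * b = 1) : b = 1 := by
  have := h.unit a b hab
  rwa [this, one_mul] at hab

open MulOpposite in
-- The hypotheses are self-dual, so each statement about R-classes yields its L-version in the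
-- opposite monoid.
theorem IsPN.opposite (h : IsPN M) : IsPN Mᵐᵒᵖ where
  unit a b hab := by
    apply unop_injective
    exact h.right_unit (a := unop b) (by simpa using congrArg unop hab)
  nonNil z a b B ha hb hB hab := by
    have h1 := hB.antiHom (U' := Set.univ) (A' := {s | JLE (unop z) s}) unop unop_injective
      (fun _ _ => rfl) (fun _ _ => Set.mem_univ _) (fun s hs => jLE_op.1 hs)
    have h2 := h.nonNil (unop z) (unop a) (unop b) _ (by simpa using ha) (by simpa using hb) h1
      ⟨_, hab, Or.inl rfl⟩
    exact h2.antiHom MulOpposite.op op_injective rfl (fun _ _ => rfl) (fun s hs => jLE_op.2 hs)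

end Inv

/-! ### Shrinking invariant sets; commuting generators -/

section InvTools

variable {M : Type*} [Monoid M]

theorem Inv.inter {U A : Set M} {B : Set (M × M)} (h : Inv U A B) (C : Set (M × M))
    (hC : ∀ p ∈ B, p ∈ C → ∀ w ∈ U, (p.1 * w * p.2, p.2 * w * p.1) ∈ B →
      (p.1 * w * p.2, p.2 * w * p.1) ∈ C) : Inv U A (B ∩ C) where
  ne p hp := h.ne p hp.1
  left p hp := h.left p hp.1
  right p hp := h.right p hp.1
  step p hp := (h.step p hp.1).imp fun w hw => ⟨hw.1, hw.2, hC p hp.1 hp.2 w hw.1 hw.2⟩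

/-- Take a first coordinate that is J-minimal in B. Each pair with both coordinates below it has a
successor whose first coordinate is a multiple of both, and minimality forces everything into one
J-class. -/
theorem Inv.exists_jEq [Finite M] {U A : Set M} {B : Set (M × M)} (h : Inv U A B)
    (hB : B.Nonempty) : ∃ z ∈ A, ∃ B' ⊆ B, B'.Nonempty ∧ Inv U {s | JLE z s} B' ∧
      ∀ p ∈ B', JEq z p.1 ∧ JEq z p.2 := by
  obtain ⟨p, hp, hmin⟩ :=
    (measure (fun p : M × M => {s : M | JLE s p.1}.ncard)).wf.has_min B hB
  have key : ∀ q ∈ B, JLE q.1 p.1 → JLE p.1 q.1 := by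
    intro q hq hle
    by_contra hn
    apply hmin q hq
    apply Set.ncard_lt_ncard _ (Set.toFinite _)
    exact ⟨fun s hs => JLE.trans hs hle, fun hsub => hn (hsub (JLE.refl p.1))⟩
  have key2 : ∀ q ∈ B, JLE q.1 p.1 → JLE q.2 p.1 → JEq p.1 q.1 ∧ JEq p.1 q.2 := by
    intro q hq h1 h2
    obtain ⟨w, -, hw⟩ := h.step q hq
    have h3 := key _ hw ((JLE.of_mul_left (JLE.of_mul_left (JLE.refl _))).trans h1)
    exact ⟨⟨key q hq h1, h1⟩, h3.of_mul_right, h2⟩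
  refine ⟨p.1, h.left p hp, B ∩ {q | JLE q.1 p.1 ∧ JLE q.2 p.1}, Set.inter_subset_left, ?_, ?_,
    fun q hq => key2 q hq.1 hq.2.1 hq.2.2⟩
  · obtain ⟨w, -, hw⟩ := h.step p hp
    exact ⟨_, hw, (JLE.refl _).of_mul_left.of_mul_left, (JLE.refl _).of_mul_right⟩
  · have h1 := h.inter {q | JLE q.1 p.1 ∧ JLE q.2 p.1} (fun q _ hq w _ _ =>
      ⟨(JLE.refl (q.1 * w * q.2)).of_mul_left.of_mul_left.trans hq.1,
        (JLE.refl (q.2 * w * q.1)).of_mul_left.of_mul_left.trans hq.2⟩)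
    exact ⟨h1.ne, fun q hq => (key2 q hq.1 hq.2.1 hq.2.2).1.1,
      fun q hq => (key2 q hq.1 hq.2.1 hq.2.2).2.1, h1.step⟩

theorem Inv.not_comm {U A : Set M} {B : Set (M × M)} (h : Inv U A B) {p : M × M} (hp : p ∈ B)
    (hcomm : ∀ w ∈ U, (p.1 * w * p.2, p.2 * w * p.1) ∈ B → p.1 * w * p.2 = p.2 * w * p.1) :
    False := by
  obtain ⟨w, hw, hs⟩ := h.step p hp
  exact h.ne _ hs (hcomm w hw hs)

theorem commute_of_mem_closure {a b : M} (hab : a * b = b * a) {c d : M}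
    (hc : c ∈ Submonoid.closure {a, b}) (hd : d ∈ Submonoid.closure {a, b}) : Commute c d := by
  have h1 : ∀ x ∈ ({a, b} : Set M), ∀ y ∈ ({a, b} : Set M), Commute x y := by
    rintro x (rfl | rfl) y (rfl | rfl)
    exacts [rfl, hab, hab.symm, rfl]
  induction hc using Submonoid.closure_induction with
  | one => exact Commute.one_left d
  | mul x y _ _ hx hy => exact hx.mul_left hy
  | mem x hx =>
    induction hd using Submonoid.closure_induction with
    | one => exact Commute.one_right x
    | mul y y' _ _ h1 h2 => exact h1.mul_right h2
    | mem y hy => exact h1 x hx y hy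

theorem mul_mul_eq_of_commute {a b c : M} (h1 : Commute a b) (h2 : Commute a c)
    (h3 : Commute b c) : a * b * c = c * b * a := by
  rw [h1.eq, mul_assoc, h2.eq, ← mul_assoc, h3.eq]

theorem not_nonNil_of_comm {A : Set M} {a b : M} (hab : a * b = b * a) : ¬ NonNil A a b := by
  rintro ⟨B, ⟨p, hp⟩, h2, h3⟩
  refine h3.not_comm hp fun w hw _ => ?_
  have := h2 p hp
  exact mul_mul_eq_of_commute (commute_of_mem_closure hab this.1 hw)
    (commute_of_mem_closure hab this.1 this.2) (commute_of_mem_closure hab hw this.2)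

theorem IsPN.eq_one_of_jLE (hM : IsPN M) {a : M} (h : JLE 1 a) : a = 1 := by
  obtain ⟨u, v, h⟩ := h
  exact hM.right_unit (hM.unit _ _ h.symm)

end InvTools

/-! ### Invariant pairs are not H-related -/

section JClass

variable {M : Type*} [Monoid M] [Finite M]

/-- A power of xw is an idempotent e = xg that fixes x and y on the left. Right translation by g is
injective on the L-class of x and carries the pairs in it to an invariant set containing (e, yg).
These two elements commute, so they cannot generate a non-nilpotent submonoid. -/
theorem IsPN.not_hEq (hM : IsPN M) {z : M} {B : Set (M × M)}
    (h : Inv Set.univ {s | JLE z s} B) {p : M × M} (hp : p ∈ B) (hJ : JEq z p.1)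
    (hR : REq p.1 p.2) (hL : LEq p.1 p.2) : False := by
  obtain ⟨x, y⟩ := p
  dsimp only at hJ hR hL
  have hJy : JEq z y := hJ.trans hR.jEq
  obtain ⟨w, -, hs⟩ := h.step _ hp
  have hxwy : JLE z (x * w * y) := h.left _ hs
  have hL1 : LEq x (x * w * x) := by
    obtain ⟨s, hs'⟩ := hR.1
    have h1 := (hJy.lEq_mul hxwy).mul_right s
    rwa [mul_assoc, ← hs'] at h1
  have hpow : ∀ n, (∃ t, (x * w) ^ n * x = x * t) ∧ LEq x ((x * w) ^ n * x) := by
    intro n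
    induction n with
    | zero => simpa using ⟨⟨1, by simp⟩, LEq.refl x⟩
    | succ n ih =>
      obtain ⟨⟨t, ht⟩, h1⟩ := ih
      rw [pow_succ', mul_assoc, ht]
      refine ⟨⟨w * (x * t), by simp only [mul_assoc]⟩, ?_⟩
      have h2 := hL1.mul_right t
      rw [← ht] at h2
      have h3 := h1.trans h2
      rwa [mul_assoc] at h3
  obtain ⟨n, hn, he⟩ := exists_pow_idempotent (x * w)
  obtain ⟨⟨t, ht⟩, hLn⟩ := hpow n
  set e := (x * w) ^ n with hedef
  have hex : e * x = x := by
    have h1 : REq x (x * t) := hJ.rEq_mul (by rw [← ht]; exact hJ.1.trans hLn.jEq.1)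
    obtain ⟨u, hu⟩ := h1.1
    rw [← ht] at hu
    conv_lhs => rw [hu]
    rw [← mul_assoc, ← mul_assoc, he, ← hu]
  obtain ⟨g, hg⟩ : ∃ g, x * g = e := by
    refine ⟨w * (x * w) ^ (n - 1), ?_⟩
    rw [hedef, ← mul_assoc, ← pow_succ', Nat.sub_add_cancel hn]
  have hey : e * y = y := by
    obtain ⟨s, hs'⟩ := hR.2
    rw [hs', ← mul_assoc, hex]
  have hgx : ∀ q, LEq x q → q * g * x = q := by
    rintro q ⟨-, v, rfl⟩
    rw [mul_assoc v, hg, mul_assoc, hex]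
  have h0 := h.inter {q | (JEq z q.1 ∧ LEq x q.1) ∧ JEq z q.2 ∧ LEq x q.2} (by
    rintro q - ⟨⟨h1, h2⟩, h3, h4⟩ w' - hB
    have h5 := h3.lEq_mul (h.left _ hB)
    have h6 := h1.lEq_mul (h.right _ hB)
    exact ⟨⟨h3.trans h5.jEq, h4.trans h5⟩, h1.trans h6.jEq, h2.trans h6⟩)
  have hInv : Inv Set.univ {s | JLE z s} ((fun q : M × M => (q.1 * g, q.2 * g)) ''
      (B ∩ {q | (JEq z q.1 ∧ LEq x q.1) ∧ JEq z q.2 ∧ LEq x q.2})) := by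
    constructor
    · rintro _ ⟨q, hq, rfl⟩ heq
      apply h0.ne q hq
      rw [← hgx q.1 hq.2.1.2, ← hgx q.2 hq.2.2.2]
      exact congrArg (· * x) heq
    · rintro _ ⟨q, hq, rfl⟩
      refine JLE.of_mul_left (b := x) ?_
      dsimp only
      rw [hgx q.1 hq.2.1.2]
      exact hq.2.1.1.1
    · rintro _ ⟨q, hq, rfl⟩
      refine JLE.of_mul_left (b := x) ?_
      dsimp only
      rw [hgx q.2 hq.2.2.2]
      exact hq.2.2.1.1
    · rintro _ ⟨q, hq, rfl⟩
      obtain ⟨w', -, hw'⟩ := h0.step q hq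
      -- The extra factor x cancels g, because qgx = q on the L-class of x.
      refine ⟨x * w', Set.mem_univ _, _, hw', ?_⟩
      dsimp only
      simp only [← mul_assoc]
      rw [hgx q.1 hq.2.1.2, hgx q.2 hq.2.2.2]
  have hne := h.ne _ hp
  have hxy1 : x = 1 → y = 1 := by
    rintro rfl
    exact hM.eq_one_of_jLE hR.jEq.1
  have hyx1 : y = 1 → x = 1 := by
    rintro rfl
    exact hM.eq_one_of_jLE hR.jEq.2
  refine not_nonNil_of_comm ?_ (hM.nonNil z (x * g) (y * g) _ ?_ ?_ hInv
    ⟨(x, y), ⟨hp, ⟨hJ, LEq.refl x⟩, hJy, hL⟩, rfl⟩)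
  · obtain ⟨v, hv⟩ := hL.2
    rw [hg]
    calc e * (y * g) = v * (e * e) := by rw [← mul_assoc, hey, hv, mul_assoc, hg, he]
      _ = y * g * e := by rw [← mul_assoc, ← hg, hv]; simp only [mul_assoc]
  · intro h1
    have := hM.unit _ _ h1
    exact hne (this.trans (hxy1 this).symm)
  · intro h1
    have := hM.unit _ _ h1
    exact hne ((hyx1 this).trans this.symm)

end JClass

/-! ### Words in two generators -/

section Closure

variable {M : Type*} [Monoid M]

theorem eq_one_or_of_mem_closure_pair {x y t : M} (ht : t ∈ Submonoid.closure {x, y}) :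
    t = 1 ∨ (∃ t' ∈ Submonoid.closure {x, y}, t = x * t') ∨
      ∃ t' ∈ Submonoid.closure {x, y}, t = y * t' := by
  induction ht using Submonoid.closure_induction_left with
  | one => exact Or.inl rfl
  | mul_left a ha t' ht' _ =>
    rcases ha with rfl | ha
    · exact Or.inr (Or.inl ⟨t', ht', rfl⟩)
    · rw [Set.mem_singleton_iff] at ha
      exact Or.inr (Or.inr ⟨t', ht', by rw [ha]⟩)

end Closure

/-! ### J-classes carrying invariant pairs are full -/

section JClass

variable {M : Type*} [Monoid M]

/-- The `J`-class of `z` is closed under multiplication. -/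
def IsFull (z : M) : Prop := ∀ a b, JEq z a → JEq z b → JLE z (a * b)

open MulOpposite in
theorem isFull_op {z : M} : IsFull (op z) ↔ IsFull z := by
  constructor
  · intro h a b ha hb
    exact jLE_op.1 (h (op b) (op a) (jEq_op.2 hb) (jEq_op.2 ha))
  · intro h a b ha hb
    exact jLE_op.2 (h (unop b) (unop a) (jEq_op.1 hb) (jEq_op.1 ha))

/-- Otherwise neither xx nor xy, a right multiple of xx, is above z, so the words in x and y above z
are only powers of y, possibly followed by one x. On such words every Mal'cev step that stays above
z makes the coordinates equal. -/
theorem IsPN.jLE_mul_self (hM : IsPN M) {z x y : M} {B : Set (M × M)}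
    (h : Inv Set.univ {s | JLE z s} B) (hp : (x, y) ∈ B) (hJ : JEq z x) (hR : REq x y) :
    JLE z (x * x) := by
  by_contra hxx
  have hne := h.ne _ hp
  have hxy : ¬ JLE z (x * y) := by
    obtain ⟨v, hv⟩ := hR.2
    rw [hv, ← mul_assoc]
    exact fun h => hxx h.of_mul_left
  have hx1 : x ≠ 1 := by
    rintro rfl
    exact hne (hM.eq_one_of_jLE hR.jEq.1).symm
  have hy1 : y ≠ 1 := by
    rintro rfl
    exact hne (hM.eq_one_of_jLE hR.jEq.2)
  have kill : ∀ (k : ℕ) (t : M), t ∈ Submonoid.closure {x, y} → JLE z (y ^ k * x * t) →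
      t = 1 := by
    intro k t ht hle
    rw [mul_assoc] at hle
    have hle' := hle.of_mul_right
    rcases eq_one_or_of_mem_closure_pair ht with h1 | ⟨t', -, rfl⟩ | ⟨t', -, rfl⟩
    · exact h1
    · rw [← mul_assoc] at hle'
      exact absurd hle'.of_mul_left hxx
    · rw [← mul_assoc] at hle'
      exact absurd hle'.of_mul_left hxy
  have form : ∀ t ∈ Submonoid.closure {x, y}, JLE z t →
      (∃ k, t = y ^ k) ∨ ∃ k, t = y ^ k * x := by
    intro t ht
    induction ht using Submonoid.closure_induction_right with
    | one => exact fun _ => Or.inl ⟨0, by simp⟩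
    | mul_right t ht a ha ih =>
      intro hle
      have ha' : a = x ∨ a = y := ha
      rcases ih hle.of_mul_left with ⟨k, rfl⟩ | ⟨k, rfl⟩
      · rcases ha' with rfl | rfl
        · exact Or.inr ⟨k, rfl⟩
        · exact Or.inl ⟨k + 1, (pow_succ _ _).symm⟩
      · have h1 := kill k a (Submonoid.subset_closure ha) hle
        rcases ha' with rfl | rfl
        · exact absurd h1 hx1
        · exact absurd h1 hy1
  obtain ⟨B', ⟨⟨c, d⟩, hcd⟩, hcl, hB'⟩ := hM.nonNil z x y B hx1 hy1 h hp
  refine hB'.not_comm hcd fun w hw hs => ?_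
  obtain ⟨hc, hd⟩ := hcl _ hcd
  have h1 : JLE z (c * w * d) := hB'.left _ hs
  have h2 : JLE z (d * w * c) := hB'.right _ hs
  dsimp only at hc hd ⊢
  rcases form c hc (hB'.left _ hcd) with ⟨k, rfl⟩ | ⟨k, rfl⟩
  · rcases form d hd (hB'.right _ hcd) with ⟨l, rfl⟩ | ⟨l, rfl⟩
    · rcases form w hw h1.of_mul_left.of_mul_right with ⟨m, rfl⟩ | ⟨m, rfl⟩
      · rw [← pow_add, ← pow_add, ← pow_add, ← pow_add]
        congr 1
        ring
      · rw [mul_assoc] at h1 h2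
        rw [kill m _ hd h1.of_mul_right, kill m _ hc h2.of_mul_right]
    · rw [mul_assoc] at h2
      have h3 := kill l _ (mul_mem hw hc) h2
      rw [hM.unit _ _ h3, hM.right_unit h3]
      simp
  · rw [mul_assoc] at h1
    have h3 := kill k _ (mul_mem hw hd) h1
    rw [hM.unit _ _ h3, hM.right_unit h3]
    simp

variable [Finite M]

/-- Choose u = sx with x L u R v. Left translation by s moves the pair to (u, sy), again R-related,
so u² is above z; and u² is J-equivalent to xv. -/
theorem IsPN.jLE_mul_of_rEq (hM : IsPN M) {z x y : M} {B : Set (M × M)}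
    (h : Inv Set.univ {s | JLE z s} B) (hp : (x, y) ∈ B) (hJ : JEq z x) (hR : REq x y)
    {v : M} (hv : JEq z v) : JLE z (x * v) := by
  obtain ⟨u, hxu, hvu⟩ := REq.exists_mid hJ hv
  obtain ⟨s, hs⟩ := hxu.2
  obtain ⟨s', hs'⟩ := hxu.1
  have hss : ∀ q, REq x q → s' * (s * q) = q := by
    rintro q ⟨-, t, rfl⟩
    rw [← mul_assoc s, ← hs, ← mul_assoc, ← hs']
  have h0 := h.inter {q | (JEq z q.1 ∧ REq x q.1) ∧ JEq z q.2 ∧ REq x q.2} (by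
    rintro q - ⟨⟨h1, h2⟩, h3, h4⟩ w' - hB
    have e1 := mul_assoc q.1 w' q.2
    have e2 := mul_assoc q.2 w' q.1
    have h5 := h1.rEq_mul (s := w' * q.2) (e1 ▸ h.left _ hB)
    have h6 := h3.rEq_mul (s := w' * q.1) (e2 ▸ h.right _ hB)
    rw [← e1] at h5
    rw [← e2] at h6
    exact ⟨⟨h1.trans h5.jEq, h2.trans h5⟩, h3.trans h6.jEq, h4.trans h6⟩)
  have hInv : Inv Set.univ {s | JLE z s} ((fun q : M × M => (s * q.1, s * q.2)) ''
      (B ∩ {q | (JEq z q.1 ∧ REq x q.1) ∧ JEq z q.2 ∧ REq x q.2})) := by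
    constructor
    · rintro _ ⟨q, hq, rfl⟩ heq
      apply h0.ne q hq
      rw [← hss q.1 hq.2.1.2, ← hss q.2 hq.2.2.2]
      exact congrArg (s' * ·) heq
    · rintro _ ⟨q, hq, rfl⟩
      refine JLE.of_mul_right (a := s') ?_
      dsimp only
      rw [hss q.1 hq.2.1.2]
      exact hq.2.1.1.1
    · rintro _ ⟨q, hq, rfl⟩
      refine JLE.of_mul_right (a := s') ?_
      dsimp only
      rw [hss q.2 hq.2.2.2]
      exact hq.2.2.1.1
    · rintro _ ⟨q, hq, rfl⟩
      obtain ⟨w', -, hw'⟩ := h0.step q hq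
      refine ⟨w' * s', Set.mem_univ _, _, hw', ?_⟩
      have e1 := hss q.1 hq.2.1.2
      have e2 := hss q.2 hq.2.2.2
      simp only [mul_assoc, e1, e2]
  have huJ : JEq z u := hJ.trans hxu.jEq
  have huu : JLE z (u * u) := by
    refine hM.jLE_mul_self (y := s * y) hInv ⟨(x, y), ⟨hp, ⟨hJ, REq.refl x⟩,
      hJ.trans hR.jEq, hR⟩, by rw [hs]⟩ huJ ?_
    rw [hs]
    exact hR.mul_left s
  exact (huu.trans (hvu.symm.mul_left u).jEq.1).trans (hxu.symm.mul_right v).jEq.1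

/-- Both pkq and qkp stay in the R-class of x, while pkq is L-equivalent to q. The single parameter
k therefore swaps the two distinct L-classes forever. -/
theorem inv_rows {z x b k : M} (hx : JEq z x) (hk : JEq z k) (hxk : JLE z (x * k))
    (hbk : JLE z (b * k)) (hkx : JLE z (k * x)) (hL : ¬ LEq x b) :
    Inv Set.univ {s | JLE z s} {p : M × M | REq x p.1 ∧ REq x p.2 ∧
      (LEq x p.1 ∧ LEq b p.2 ∨ LEq b p.1 ∧ LEq x p.2)} := by
  have hL1 : ∀ p, LEq x p ∨ LEq b p → JLE z (p * k) := by
    rintro p (h | h)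
    · exact hxk.trans (h.mul_right k).jEq.1
    · exact hbk.trans (h.mul_right k).jEq.1
  have hR1 : ∀ q, REq x q → JLE z (k * q) := fun q h => hkx.trans (h.mul_left k).jEq.1
  have main : ∀ p q, REq x p → REq x q → LEq x p ∨ LEq b p →
      REq x (p * k * q) ∧ LEq q (p * k * q) := by
    intro p q hp hq hpL
    have h1 : JEq z (p * k * q) := hk.mul_mul (hL1 p hpL) (hR1 q hq)
    refine ⟨?_, (hx.trans hq.jEq).lEq_mul h1.1⟩
    have h2 := (hx.trans hp.jEq).rEq_mul (s := k * q) (by rw [← mul_assoc]; exact h1.1)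
    rw [← mul_assoc] at h2
    exact hp.trans h2
  constructor
  · rintro ⟨p, q⟩ ⟨-, -, ⟨h1, h2⟩ | ⟨h1, h2⟩⟩ (rfl : p = q)
    · exact hL (h1.trans h2.symm)
    · exact hL (h2.trans h1.symm)
  · rintro p ⟨h, -⟩
    exact hx.1.trans h.jEq.1
  · rintro p ⟨-, h, -⟩
    exact hx.1.trans h.jEq.1
  · rintro p ⟨h1, h2, h3⟩
    have m1 := main p.1 p.2 h1 h2 (h3.imp And.left And.left)
    have m2 := main p.2 p.1 h2 h1 (h3.symm.imp And.right And.right)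
    exact ⟨k, Set.mem_univ _, m1.1, m2.1,
      h3.symm.imp (fun h => ⟨h.2.trans m1.2, h.1.trans m2.2⟩)
        (fun h => ⟨h.2.trans m1.2, h.1.trans m2.2⟩)⟩

/-- Slide a along its L-class to b in the R-class of x. Either b L x, or `inv_rows` exhibits (b, x)
as an invariant pair; in both cases `IsPN.jLE_mul_of_rEq` applies. -/
theorem IsPN.isFull_of_rEq (hM : IsPN M) {z x y : M} {B : Set (M × M)}
    (h : Inv Set.univ {s | JLE z s} B) (hp : (x, y) ∈ B) (hJ : JEq z x) (hR : REq x y) :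
    IsFull z := by
  intro a v ha hv
  have hstar := fun {v} => hM.jLE_mul_of_rEq h hp hJ hR (v := v)
  obtain ⟨b, hab, hxb⟩ := REq.exists_mid ha hJ
  have hb : JEq z b := ha.trans hab.jEq
  refine JLE.trans ?_ (hab.mul_right v).jEq.2
  by_cases hL : LEq x b
  · exact (hstar hv).trans (hL.mul_right v).jEq.1
  obtain ⟨⟨t', ht'⟩, t, ht⟩ := id hxb
  have hxx : JLE z (x * x) := hstar hJ
  -- The parameter k = t'x is chosen because x = bt', so bk = x².
  have hbk : JLE z (b * (t' * x)) := by rwa [← mul_assoc, ← ht']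
  have hk : JEq z (t' * x) := hJ.mul_of_left hbk.of_mul_right
  have hxk : LEq x (t' * x) := hJ.lEq_mul hk.1
  have hkx : JLE z (t' * x * x) := hxx.trans (hxk.mul_right x).jEq.1
  exact hM.jLE_mul_of_rEq (inv_rows hJ hk (hstar hk) hbk hkx hL)
    (x := b) (y := x) ⟨hxb, REq.refl x, Or.inr ⟨LEq.refl b, LEq.refl x⟩⟩ hb
    (REq.symm hxb) hv

theorem IsPN.isFull_of_not_lEq (hM : IsPN M) {z c d k : M} (hc : JEq z c) (hd : JEq z d)
    (hk : JEq z k) (hck : JLE z (c * k)) (hdk : JLE z (d * k)) (hkc : JLE z (k * c))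
    (hL : ¬ LEq c d) : IsFull z := by
  obtain ⟨m, hdm, hcm⟩ := REq.exists_mid hd hc
  exact hM.isFull_of_rEq (inv_rows hc hk hck hdk hkc hL)
    (x := c) (y := m) ⟨REq.refl c, hcm, Or.inl ⟨LEq.refl c, hdm⟩⟩ hc hcm

open MulOpposite in
theorem IsPN.isFull_of_not_rEq (hM : IsPN M) {z c d k : M} (hc : JEq z c) (hd : JEq z d)
    (hk : JEq z k) (hck : JLE z (k * c)) (hdk : JLE z (k * d)) (hkc : JLE z (c * k))
    (hR : ¬ REq c d) : IsFull z :=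
  have := Finite.of_equiv M opEquiv
  isFull_op.1 (hM.opposite.isFull_of_not_lEq (c := op c) (d := op d) (k := op k) (jEq_op.2 hc)
    (jEq_op.2 hd) (jEq_op.2 hk) (jLE_op.2 hck) (jLE_op.2 hdk) (jLE_op.2 hkc)
    (fun h => hR (lEq_op.1 h)))

/-- Inside the submonoid generated by the pair, every element other than 1 and above z is in the
J-class of z. A parameter other than 1 thus serves as the k of the two preceding lemmas, whose L-
and R-cases are exhaustive by `IsPN.not_hEq`. -/
theorem IsPN.isFull_of_inv (hM : IsPN M) {z : M} {B : Set (M × M)}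
    (h : Inv Set.univ {s | JLE z s} B) {p : M × M} (hp : p ∈ B) (h1 : JEq z p.1)
    (h2 : JEq z p.2) : IsFull z := by
  have hne := h.ne p hp
  have hx1 : p.1 ≠ 1 := fun e => hne (by
    rw [e] at h1 ⊢
    exact (hM.eq_one_of_jLE (h1.symm.trans h2).1).symm)
  have hy1 : p.2 ≠ 1 := fun e => hne (by
    rw [e] at h2 ⊢
    exact hM.eq_one_of_jLE (h2.symm.trans h1).1)
  obtain ⟨B', ⟨q, hq⟩, hcl, hB'⟩ := hM.nonNil z p.1 p.2 B hx1 hy1 h hp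
  have hJ : ∀ t ∈ Submonoid.closure {p.1, p.2}, t ≠ 1 → JLE z t → JEq z t := by
    intro t ht ht1 hle
    refine ⟨hle, ?_⟩
    rcases eq_one_or_of_mem_closure_pair ht with h | ⟨t', -, rfl⟩ | ⟨t', -, rfl⟩
    · exact absurd h ht1
    · exact (JLE.mul_right _ _).trans h1.2
    · exact (JLE.mul_right _ _).trans h2.2
  have hfin : ∀ c d k : M, (c, d) ∈ B' → JEq z c → JEq z d → JEq z k → JLE z (c * k) →
      JLE z (d * k) → JLE z (k * c) → JLE z (k * d) → IsFull z := by
    intro c d k hcd hc hd hk e1 e2 e3 e4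
    by_cases hL : LEq c d
    · by_cases hR : REq c d
      · exact (hM.not_hEq (hB'.mono (Set.subset_univ _) subset_rfl) hcd hc hR hL).elim
      · exact hM.isFull_of_not_rEq hc hd hk e3 e4 e1 hR
    · exact hM.isFull_of_not_lEq hc hd hk e1 e2 e3 hL
  have hstep : ∀ q ∈ B', ∃ w ∈ Submonoid.closure {p.1, p.2},
      (q.1 * w * q.2, q.2 * w * q.1) ∈ B' ∧ JEq z (q.1 * w * q.2) ∧ JEq z (q.2 * w * q.1) := by
    intro q hq
    obtain ⟨w, hw, hs⟩ := hB'.step q hq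
    refine ⟨w, hw, hs, hJ _ (hcl _ hs).1 ?_ (hB'.left _ hs), hJ _ (hcl _ hs).2 ?_ (hB'.right _ hs)⟩
    · intro e
      have e1 := hM.right_unit e
      have e2 := hM.unit _ _ (hM.unit _ _ e)
      exact hB'.ne q hq (e2.trans e1.symm)
    · intro e
      have e1 := hM.right_unit e
      have e2 := hM.unit _ _ (hM.unit _ _ e)
      exact hB'.ne q hq (e1.trans e2.symm)
  have hw1 : ∀ c d w : M, (c, d) ∈ B' → JEq z c → JEq z d →
      w ∈ Submonoid.closure {p.1, p.2} → w ≠ 1 → JLE z (c * w * d) → JLE z (d * w * c) →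
      IsFull z := by
    intro c d w hcd hc hd hw hw1 e1 e2
    exact hfin c d w hcd hc hd (hJ w hw hw1 e1.of_mul_left.of_mul_right) e1.of_mul_left
      e2.of_mul_left (by rw [mul_assoc] at e2; exact e2.of_mul_right)
      (by rw [mul_assoc] at e1; exact e1.of_mul_right)
  -- A coordinate of q may be 1; after one step both coordinates are in the J-class.
  obtain ⟨w0, -, hcd, hc, hd⟩ := hstep q hq
  set c := q.1 * w0 * q.2
  set d := q.2 * w0 * q.1
  obtain ⟨w, hw, hcd', hc', hd'⟩ := hstep _ hcd
  dsimp only at hw hcd' hc' hd'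
  by_cases hw_one : w = 1
  · subst hw_one
    simp only [mul_one] at hcd' hc' hd'
    obtain ⟨w', hw', -, hc2, hd2⟩ := hstep _ hcd'
    dsimp only at hc2 hd2
    by_cases hw_one' : w' = 1
    · subst hw_one'
      simp only [mul_one] at hc2 hd2
      -- Two trivial parameters in a row put dccd above z, hence c², and c itself plays the role of
      -- k.
      have hcc : JLE z (c * c) := by
        have := hd2.1
        rw [mul_assoc, ← mul_assoc c] at this
        exact this.of_mul_right.of_mul_left
      exact hfin c d c hcd hc hd hc hcc hd'.1 hcc hc'.1
    · exact hw1 _ _ w' hcd' hc' hd' hw' hw_one' hc2.1 hd2.1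
  · exact hw1 _ _ w hcd hc hd hw hw_one hc'.1 hd'.1

end JClass

/-! ### Action of the elements above a full J-class -/

section Full

variable {M : Type*} [Monoid M]

/-- If z = usv, then s(vz) is in the J-class, because its left multiple uz-product usvz = z² is;
multiplying by j and cutting off vz leaves js above z. -/
theorem IsFull.jEq_mul_right {z s j : M} (hf : IsFull z) (hs : JLE z s) (hj : JEq z j) :
    JEq z (j * s) := by
  refine hj.mul_of_right ?_
  obtain ⟨u, v, huv⟩ := id hs
  have h1 : JLE z (u * s * v * z) := by
    rw [← huv]
    exact hf z z (.refl z) (.refl z)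
  have h2 : JLE z (s * (v * z)) := by
    rw [mul_assoc, mul_assoc] at h1
    exact h1.of_mul_right
  have h3 : JEq z (s * (v * z)) := ⟨h2, (JLE.mul_left s (v * z)).trans (JLE.mul_left v z)⟩
  have h4 := hf j _ hj h3
  rw [← mul_assoc] at h4
  exact h4.of_mul_left

theorem IsFull.jEq_mul_left {z s j : M} (hf : IsFull z) (hs : JLE z s) (hj : JEq z j) :
    JEq z (s * j) := by
  refine hj.mul_of_left ?_
  have h1 := hf _ _ (hf.jEq_mul_right hs hj) hj
  rw [mul_assoc] at h1
  exact h1.of_mul_right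

theorem IsFull.jLE_mul {z s t : M} (hf : IsFull z) (hs : JLE z s) (ht : JLE z t) :
    JLE z (s * t) := by
  have := (hf.jEq_mul_left hs (hf.jEq_mul_left ht (.refl z))).1
  rw [← mul_assoc] at this
  exact this.of_mul_left

theorem IsFull.jLE_pow {z s : M} (hf : IsFull z) (hs : JLE z s) (n : ℕ) : JLE z (s ^ n) := by
  induction n with
  | zero => simpa using JLE.one z
  | succ n ih => rw [pow_succ]; exact hf.jLE_mul ih hs

theorem IsFull.jLE_of_mem_closure {z x y c : M} (hf : IsFull z) (hx : JLE z x) (hy : JLE z y)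
    (hc : c ∈ Submonoid.closure {x, y}) : JLE z c := by
  induction hc using Submonoid.closure_induction with
  | mem c hc =>
    rcases hc with rfl | hc
    · exact hx
    · exact (Set.mem_singleton_iff.1 hc) ▸ hy
  | one => exact JLE.one z
  | mul a b _ _ ha hb => exact hf.jLE_mul ha hb

variable [Finite M]

theorem IsFull.rEq_mul {z s j : M} (hf : IsFull z) (hs : JLE z s) (hj : JEq z j) :
    REq j (j * s) := hj.rEq_mul (hf.jEq_mul_right hs hj).1

theorem IsFull.lEq_mul {z s j : M} (hf : IsFull z) (hs : JLE z s) (hj : JEq z j) :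
    LEq j (s * j) := hj.lEq_mul (hf.jEq_mul_left hs hj).1

/-- One step with w puts (a, b) among the pairs of the J-class with different R-classes. These are
closed under steps with parameter 1, since pq R p. -/
theorem IsPN.nonNil_of_not_rEq (hM : IsPN M) {z a b w : M} (hf : IsFull z) (ha1 : a ≠ 1)
    (hb1 : b ≠ 1) (ha : JLE z a) (hb : JLE z b) (hw : JEq z w) (h : ¬ REq (a * w) (b * w)) :
    NonNil {s | JLE z s} a b := by
  have haw := hf.jEq_mul_left ha hw
  have hbw := hf.jEq_mul_left hb hw
  refine hM.nonNil z a b (insert (a, b) {p | JEq z p.1 ∧ JEq z p.2 ∧ ¬ REq p.1 p.2}) ha1 hb1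
    ?_ (Set.mem_insert _ _)
  constructor
  · rintro p (rfl | ⟨-, -, hp⟩)
    · rintro (rfl : a = b)
      exact h (.refl _)
    · intro e
      rw [e] at hp
      exact hp (.refl _)
  · rintro p (rfl | hp)
    · exact ha
    · exact hp.1.1
  · rintro p (rfl | hp)
    · exact hb
    · exact hp.2.1.1
  · rintro p (rfl | ⟨h1, h2, hp⟩)
    · exact ⟨w, Set.mem_univ _, Or.inr ⟨hf.jEq_mul_right hb haw, hf.jEq_mul_right ha hbw,
        fun e => h (((hf.rEq_mul hb haw).trans e).trans (hf.rEq_mul ha hbw).symm)⟩⟩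
    · refine ⟨1, Set.mem_univ _, Or.inr ?_⟩
      simp only [mul_one]
      exact ⟨hf.jEq_mul_right h2.1 h1, hf.jEq_mul_right h1.1 h2,
        fun e => hp (((hf.rEq_mul h2.1 h1).trans e).trans (hf.rEq_mul h1.1 h2).symm)⟩

open MulOpposite in
theorem IsPN.nonNil_of_not_lEq (hM : IsPN M) {z a b w : M} (hf : IsFull z) (ha1 : a ≠ 1)
    (hb1 : b ≠ 1) (ha : JLE z a) (hb : JLE z b) (hw : JEq z w) (h : ¬ LEq (w * a) (w * b)) :
    NonNil {s | JLE z s} a b := by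
  have := Finite.of_equiv M opEquiv
  have h1 := hM.opposite.nonNil_of_not_rEq (z := op z) (a := op a) (b := op b) (w := op w)
    (isFull_op.2 hf) (by simpa using ha1) (by simpa using hb1) (jLE_op.2 ha) (jLE_op.2 hb)
    (jEq_op.2 hw) (fun e => h (rEq_op.1 e))
  exact h1.antiHom unop unop_injective rfl (fun _ _ => rfl) (fun s hs => jLE_op.1 hs)

/-- The element a = eje commutes with e and sends the whole class into its own R-class. If e did not
send it into a single one, some w would separate ew from aw and make the commuting pair e, a
non-nilpotent. -/
theorem IsPN.rEq_idempotent_mul (hM : IsPN M) {z e j j' : M} (hf : IsFull z) (he : e * e = e)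
    (he1 : e ≠ 1) (hze : JLE z e) (hj : JEq z j) (hj' : JEq z j') : REq (e * j) (e * j') := by
  by_contra hn
  have ha : JEq z (e * j * e) := hf.jEq_mul_right hze (hf.jEq_mul_left hze hj)
  have hex : ∃ w, JEq z w ∧ ¬ REq (e * w) (e * j * e * w) := by
    by_contra! hall
    exact hn (((hall j hj).trans ((hf.rEq_mul hj.1 ha).symm.trans (hf.rEq_mul hj'.1 ha))).trans
      (hall j' hj').symm)
  obtain ⟨w, hw, hR⟩ := hex
  refine not_nonNil_of_comm ?_ (hM.nonNil_of_not_rEq hf he1 ?_ hze ha.1 hw hR)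
  · rw [mul_assoc (e * j), he, ← mul_assoc, ← mul_assoc, he]
  · intro h1
    rw [mul_assoc] at h1
    exact he1 (hM.unit _ _ h1)

open MulOpposite in
theorem IsPN.lEq_mul_idempotent (hM : IsPN M) {z e j j' : M} (hf : IsFull z) (he : e * e = e)
    (he1 : e ≠ 1) (hze : JLE z e) (hj : JEq z j) (hj' : JEq z j') : LEq (j * e) (j' * e) := by
  have := Finite.of_equiv M opEquiv
  exact rEq_op.1 (hM.opposite.rEq_idempotent_mul (z := op z) (e := op e) (j := op j) (j' := op j')
    (isFull_op.2 hf) (by rw [← op_mul, he]) (by simpa using he1) (jLE_op.2 hze) (jEq_op.2 hj)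
    (jEq_op.2 hj'))

/-- An element above a full `J`-class sends it, by left multiplication, into one `R`-class. -/
theorem IsPN.rEq_mul (hM : IsPN M) {z s j j' : M} (hf : IsFull z) (hs1 : s ≠ 1) (hs : JLE z s)
    (hj : JEq z j) (hj' : JEq z j') : REq (s * j) (s * j') := by
  by_contra hn
  obtain ⟨n, hn0, he⟩ := exists_pow_idempotent s
  have he1 : s ^ n ≠ 1 := by
    rw [← Nat.sub_add_cancel hn0, pow_succ']
    exact fun h => hs1 (hM.unit _ _ h)
  have hze := hf.jLE_pow hs n
  have hcomm : s * s ^ n = s ^ n * s := (Commute.self_pow s n).eq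
  set e := s ^ n
  -- By the idempotent case, multiplication by s on either side preserves the H-class of a. So the
  -- submonoid generated by s and a consists of powers of s and of elements of that H-class, and a
  -- Mal'cev step gives either commuting powers or an H-related pair.
  obtain ⟨a, ha⟩ : ∃ a, a = e * z * e := ⟨_, rfl⟩
  have haJ : JEq z a := by
    rw [ha]
    exact hf.jEq_mul_right hze (hf.jEq_mul_left hze (.refl z))
  have hze' := hf.jEq_mul_right hze (.refl z)
  have hez' := hf.jEq_mul_left hze (.refl z)
  have hsa : REq a (s * a) := by
    rw [ha, ← mul_assoc, ← mul_assoc, hcomm, mul_assoc, mul_assoc, mul_assoc]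
    exact hM.rEq_idempotent_mul hf he he1 hze hze' (hf.jEq_mul_left hs hze')
  have has : LEq a (a * s) := by
    rw [ha, mul_assoc _ e s, ← hcomm, ← mul_assoc]
    exact hM.lEq_mul_idempotent hf he he1 hze hez' (hf.jEq_mul_right hs hez')
  have hex : ∃ w, JEq z w ∧ ¬ REq (s * w) (a * w) := by
    by_contra! hall
    exact hn (((hall j hj).trans ((hf.rEq_mul hj.1 haJ).symm.trans
      (hf.rEq_mul hj'.1 haJ))).trans (hall j' hj').symm)
  obtain ⟨w, hw, hR⟩ := hex
  have ha1 : a ≠ 1 := by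
    rw [ha, mul_assoc]
    exact fun h1 => he1 (hM.unit _ _ h1)
  obtain ⟨B, ⟨q, hq⟩, hcl, hB⟩ := hM.nonNil_of_not_rEq hf hs1 ha1 hs haJ.1 hw hR
  have hHs : ∀ h, REq a h ∧ LEq a h → REq a (s * h) ∧ LEq a (s * h) := fun h hh =>
    ⟨hsa.trans (hh.1.mul_left s), hh.2.trans (hf.lEq_mul hs (haJ.trans hh.1.jEq))⟩
  have hsH : ∀ h, REq a h ∧ LEq a h → REq a (h * s) ∧ LEq a (h * s) := fun h hh =>
    ⟨hh.1.trans (hf.rEq_mul hs (haJ.trans hh.1.jEq)), has.trans (hh.2.mul_right s)⟩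
  have hHH : ∀ h h', REq a h ∧ LEq a h → REq a h' ∧ LEq a h' →
      REq a (h * h') ∧ LEq a (h * h') := fun h h' hh hh' =>
    ⟨hh.1.trans (hf.rEq_mul (haJ.trans hh'.1.jEq).1 (haJ.trans hh.1.jEq)),
      hh'.2.trans (hf.lEq_mul (haJ.trans hh.1.jEq).1 (haJ.trans hh'.1.jEq))⟩
  have hpH : ∀ k h, REq a h ∧ LEq a h → REq a (s ^ k * h) ∧ LEq a (s ^ k * h) := by
    intro k h hh
    induction k with
    | zero => simpa using hh
    | succ k ih => rw [pow_succ', mul_assoc]; exact hHs _ ih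
  have hHp : ∀ k h, REq a h ∧ LEq a h → REq a (h * s ^ k) ∧ LEq a (h * s ^ k) := by
    intro k h hh
    induction k with
    | zero => simpa using hh
    | succ k ih => rw [pow_succ, ← mul_assoc]; exact hsH _ ih
  have hcl' : ∀ c ∈ Submonoid.closure {s, a}, (∃ k, c = s ^ k) ∨ (REq a c ∧ LEq a c) := by
    intro c hc
    induction hc using Submonoid.closure_induction with
    | mem c hc =>
      rcases hc with rfl | hc
      · exact Or.inl ⟨1, (pow_one _).symm⟩
      · rw [Set.mem_singleton_iff.1 hc]
        exact Or.inr ⟨.refl a, .refl a⟩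
    | one => exact Or.inl ⟨0, (pow_zero s).symm⟩
    | mul x y _ _ hx hy =>
      rcases hx with ⟨k, rfl⟩ | hx
      · rcases hy with ⟨l, rfl⟩ | hy
        · exact Or.inl ⟨k + l, (pow_add s k l).symm⟩
        · exact Or.inr (hpH k y hy)
      · rcases hy with ⟨l, rfl⟩ | hy
        · exact Or.inr (hHp l x hx)
        · exact Or.inr (hHH x y hx hy)
  have hfinal : ∀ c d, (c, d) ∈ B → ¬ ((REq a c ∧ LEq a c) ∧ REq a d ∧ LEq a d) := by
    rintro c d hcd ⟨⟨h1, h2⟩, h3, h4⟩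
    exact hM.not_hEq (hB.mono (Set.subset_univ _) subset_rfl) hcd (haJ.trans h1.jEq)
      (h1.symm.trans h3) (h2.symm.trans h4)
  refine hB.not_comm hq fun w hw hs' => ?_
  rcases hcl' _ (hcl q hq).1 with ⟨k, hk⟩ | hc <;> rcases hcl' _ (hcl q hq).2 with ⟨l, hl⟩ | hd <;>
    rcases hcl' w hw with ⟨m, hm⟩ | hw'
  · rw [hk, hl, hm, ← pow_add, ← pow_add, ← pow_add, ← pow_add]
    congr 1
    ring
  all_goals refine (hfinal _ _ hs' ⟨?_, ?_⟩).elim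
  · rw [hk, hl]; exact hHp _ _ (hpH _ _ hw')
  · rw [hk, hl]; exact hHp _ _ (hpH _ _ hw')
  · rw [hk, hm, ← pow_add]; exact hpH _ _ hd
  · rw [hk, hm, mul_assoc, ← pow_add]; exact hHp _ _ hd
  · rw [hk]; exact hHH _ _ (hpH _ _ hw') hd
  · rw [hk]; exact hHp _ _ (hHH _ _ hd hw')
  · rw [hl, hm, mul_assoc, ← pow_add]; exact hHp _ _ hc
  · rw [hl, hm, ← pow_add]; exact hpH _ _ hc
  · rw [hl]; exact hHp _ _ (hHH _ _ hc hw')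
  · rw [hl]; exact hHH _ _ (hpH _ _ hw') hc
  · rw [hm]; exact hHH _ _ (hHp _ _ hc) hd
  · rw [hm]; exact hHH _ _ (hHp _ _ hd) hc
  · exact hHH _ _ (hHH _ _ hc hw') hd
  · exact hHH _ _ (hHH _ _ hd hw') hc

open MulOpposite in
theorem IsPN.lEq_mul (hM : IsPN M) {z s j j' : M} (hf : IsFull z) (hs1 : s ≠ 1) (hs : JLE z s)
    (hj : JEq z j) (hj' : JEq z j') : LEq (j * s) (j' * s) := by
  have := Finite.of_equiv M opEquiv
  exact rEq_op.1 (hM.opposite.rEq_mul (z := op z) (s := op s) (j := op j) (j' := op j')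
    (isFull_op.2 hf) (by simpa using hs1) (jLE_op.2 hs) (jEq_op.2 hj) (jEq_op.2 hj'))

/-- `x` and `y` send the full `J`-class of `z` into the same `R`-class and the same `L`-class. -/
def SameCls (z x y : M) : Prop := REq (x * z) (y * z) ∧ LEq (z * x) (z * y)

/-- A full `J`-class that is not a group. -/
def IsBig (z : M) : Prop := IsFull z ∧ ∃ a b, JEq z a ∧ JEq z b ∧ ¬ (REq a b ∧ LEq a b)

omit [Finite M] in
theorem SameCls.symm {z x y : M} (h : SameCls z x y) : SameCls z y x := ⟨h.1.symm, h.2.symm⟩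

omit [Finite M] in
theorem SameCls.trans {z x y t : M} (h : SameCls z x y) (h' : SameCls z y t) : SameCls z x t :=
  ⟨h.1.trans h'.1, h.2.trans h'.2⟩

theorem IsFull.sameCls_iff {z a b : M} (hf : IsFull z) (ha : JEq z a) (hb : JEq z b) :
    SameCls z a b ↔ REq a b ∧ LEq a b := by
  have h1 := hf.rEq_mul (JLE.refl z) ha
  have h2 := hf.rEq_mul (JLE.refl z) hb
  have h3 := hf.lEq_mul (JLE.refl z) ha
  have h4 := hf.lEq_mul (JLE.refl z) hb
  exact ⟨fun h => ⟨(h1.trans h.1).trans h2.symm, (h3.trans h.2).trans h4.symm⟩,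
    fun h => ⟨(h1.symm.trans h.1).trans h2, (h3.symm.trans h.2).trans h4⟩⟩

omit [Finite M] in
-- Otherwise the only words above z are powers of y, and these commute.
theorem Inv.jLE_left {z x y : M} {B : Set (M × M)}
    (h : Inv (Submonoid.closure {x, y} : Set M) {s | JLE z s} B) {p : M × M} (hp : p ∈ B)
    (hcl : p.1 ∈ Submonoid.closure {x, y} ∧ p.2 ∈ Submonoid.closure {x, y}) : JLE z x := by
  by_contra hx
  have hpow : ∀ c ∈ Submonoid.closure {x, y}, JLE z c → ∃ k, c = y ^ k := by
    intro c hc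
    induction hc using Submonoid.closure_induction_left with
    | one => exact fun _ => ⟨0, (pow_zero y).symm⟩
    | mul_left a ha t _ ih =>
      intro hle
      rcases ha with rfl | ha
      · exact absurd hle.of_mul_left hx
      · obtain ⟨k, rfl⟩ := ih hle.of_mul_right
        rw [Set.mem_singleton_iff.1 ha]
        exact ⟨k + 1, (pow_succ' y k).symm⟩
  refine h.not_comm hp fun w hw hs => ?_
  obtain ⟨k, hk⟩ := hpow _ hcl.1 (h.left _ hp)
  obtain ⟨l, hl⟩ := hpow _ hcl.2 (h.right _ hp)
  obtain ⟨m, hm⟩ := hpow w hw (h.left _ hs).of_mul_left.of_mul_right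
  rw [hk, hl, hm, ← pow_add, ← pow_add, ← pow_add, ← pow_add]
  congr 1
  ring

/-- By `IsPN.rEq_mul` and its dual, the first letter of a word determines its R-class and the last
letter its L-class. -/
theorem IsPN.sameCls_of_mem_closure (hM : IsPN M) {z x y c : M} (hf : IsFull z) (hx1 : x ≠ 1)
    (hy1 : y ≠ 1) (hx : JLE z x) (hy : JLE z y) (h : SameCls z x y)
    (hc : c ∈ Submonoid.closure {x, y}) (hc1 : c ≠ 1) : SameCls z x c := by
  have hz := JEq.refl z
  constructor
  · induction hc using Submonoid.closure_induction_left with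
    | one => exact absurd rfl hc1
    | mul_left a ha t ht _ =>
      have htz := hf.jEq_mul_left (hf.jLE_of_mem_closure hx hy ht) hz
      rw [mul_assoc]
      rcases ha with rfl | ha
      · exact hM.rEq_mul hf hx1 hx hz htz
      · rw [Set.mem_singleton_iff.1 ha]
        exact h.1.trans (hM.rEq_mul hf hy1 hy hz htz)
  · induction hc using Submonoid.closure_induction_right with
    | one => exact absurd rfl hc1
    | mul_right t ht a ha _ =>
      have htz := hf.jEq_mul_right (hf.jLE_of_mem_closure hx hy ht) hz
      rw [← mul_assoc]
      rcases ha with rfl | ha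
      · exact hM.lEq_mul hf hx1 hx hz htz
      · rw [Set.mem_singleton_iff.1 ha]
        exact h.2.trans (hM.lEq_mul hf hy1 hy hz htz)

/-- Shrink the invariant set to one J-class, which is then full. If x and y determined the same
H-class of it, so would all nontrivial words, and the invariant pairs would be H-related. -/
theorem IsPN.exists_isBig_of_nonNil (hM : IsPN M) {A : Set M} {x y : M} (hx1 : x ≠ 1)
    (hy1 : y ≠ 1) (h : NonNil A x y) :
    ∃ z ∈ A, IsBig z ∧ JLE z x ∧ JLE z y ∧ ¬ SameCls z x y := by
  obtain ⟨B, hB, hcl, hInv⟩ := h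
  obtain ⟨z, hzA, B', hsub, ⟨p, hp⟩, hInv', hJ⟩ := hInv.exists_jEq hB
  have hInv'' := hInv'.mono (Set.subset_univ _) subset_rfl
  obtain ⟨h1, h2⟩ := hJ p hp
  obtain ⟨hc1, hc2⟩ := hcl p (hsub hp)
  have hf : IsFull z := hM.isFull_of_inv hInv'' hp h1 h2
  have hH : ¬ (REq p.1 p.2 ∧ LEq p.1 p.2) := fun h => hM.not_hEq hInv'' hp h1 h.1 h.2
  have hx : JLE z x := hInv'.jLE_left hp ⟨hc1, hc2⟩
  have hy : JLE z y := by
    rw [Set.pair_comm] at hInv' hc1 hc2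
    exact hInv'.jLE_left hp ⟨hc1, hc2⟩
  refine ⟨z, hzA, ⟨hf, p.1, p.2, h1, h2, hH⟩, hx, hy, fun hsame => hH ?_⟩
  have hne := hInv'.ne p hp
  have hp1 : p.1 ≠ 1 := fun e => hne (by
    rw [e] at h1 ⊢
    exact (hM.eq_one_of_jLE (h1.symm.trans h2).1).symm)
  have hp2 : p.2 ≠ 1 := fun e => hne (by
    rw [e] at h2 ⊢
    exact hM.eq_one_of_jLE (h2.symm.trans h1).1)
  exact (hf.sameCls_iff h1 h2).1 ((hM.sameCls_of_mem_closure hf hx1 hy1 hx hy hsame hc1 hp1).symm.trans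
    (hM.sameCls_of_mem_closure hf hx1 hy1 hx hy hsame hc2 hp2))

theorem IsPN.nonNil_of_isFull (hM : IsPN M) {z x y : M} (hf : IsFull z) (hx1 : x ≠ 1)
    (hy1 : y ≠ 1) (hx : JLE z x) (hy : JLE z y) (h : ¬ SameCls z x y) :
    NonNil {s | JLE z s} x y := by
  by_cases hR : REq (x * z) (y * z)
  · exact hM.nonNil_of_not_lEq hf hx1 hy1 hx hy (.refl z) fun hL => h ⟨hR, hL⟩
  · exact hM.nonNil_of_not_rEq hf hx1 hy1 hx hy (.refl z) hR

end Full

/-! ### Mal'cev nilpotency of finite semigroups via invariant sets -/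

section Nilpotency

theorem exists_forall_mem_of_antitone {α : Type*} [Finite α] (C : ℕ → Set α) (hC : Antitone C)
    (hne : ∀ n, (C n).Nonempty) : ∃ a, ∀ n, a ∈ C n := by
  by_contra! h
  choose f hf using h
  obtain ⟨N, hN⟩ := Set.finite_range f |>.bddAbove
  obtain ⟨a, ha⟩ := hne N
  exact hf a (hC (hN ⟨a, rfl⟩) ha)

theorem finite_withOne {S : Type*} [Finite S] : Finite (WithOne S) :=
  inferInstanceAs (Finite (Option S))

variable {Y : Type*} [Semigroup Y]

theorem coe_sandwich (a b : Y) (w : WithOne Y) :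
    ((sandwich a w b : Y) : WithOne Y) = a * w * b := by
  induction w using WithOne.recOneCoe with
  | one => simp [sandwich]
  | coe c => simp [sandwich]

/-- The successor of a pair in Mal'cev's sequences. -/
def malcevStep (p : Y × Y) (w : WithOne Y) : Y × Y := (sandwich p.1 w p.2, sandwich p.2 w p.1)

theorem malcevPair_succ (x y : Y) (w : ℕ → WithOne Y) (n : ℕ) :
    malcevPair x y w (n + 1) = malcevStep (malcevPair x y w n) (w n) := rfl

theorem malcevPair_succ' (x y : Y) (w : ℕ → WithOne Y) (n : ℕ) :
    malcevPair x y w (n + 1) = malcevPair (malcevStep (x, y) (w 0)).1 (malcevStep (x, y) (w 0)).2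
      (fun k => w (k + 1)) n := by
  induction n with
  | zero => rfl
  | succ n ih => rw [malcevPair_succ, ih, malcevPair_succ]

theorem exists_malcevPair_mem {B : Set (Y × Y)} (h : ∀ p ∈ B, ∃ w, malcevStep p w ∈ B)
    {p : Y × Y} (hp : p ∈ B) : ∃ w : ℕ → WithOne Y, ∀ n, malcevPair p.1 p.2 w n ∈ B := by
  choose! f hf using h
  let s : ℕ → Y × Y := fun n => Nat.rec p (fun _ q => malcevStep q (f q)) n
  have hs : ∀ n, s n ∈ B := by
    intro n
    induction n with
    | zero => exact hp
    | succ n ih => exact hf _ ih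
  refine ⟨fun n => f (s n), fun n => ?_⟩
  have : malcevPair p.1 p.2 (fun n => f (s n)) n = s n := by
    induction n with
    | zero => rfl
    | succ n ih => rw [malcevPair_succ, ih]
  rw [this]
  exact hs n

theorem not_malcevNilpotent_of_set {B : Set (Y × Y)} (hB : B.Nonempty)
    (h : ∀ p ∈ B, p.1 ≠ p.2 ∧ ∃ w, malcevStep p w ∈ B) : ¬ MalcevNilpotent Y := by
  rintro ⟨n, -, hn⟩
  obtain ⟨p, hp⟩ := hB
  obtain ⟨w, hw⟩ := exists_malcevPair_mem (fun p hp => (h p hp).2) hp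
  exact (h _ (hw n)).1 (hn p.1 p.2 w)

/-- A compactness argument: the pairs that can be kept distinct for n steps form a decreasing
sequence of nonempty finite sets, and the same holds for the parameters that allow n further steps.
-/
theorem exists_set_of_not_malcevNilpotent [Finite Y] (h : ¬ MalcevNilpotent Y) :
    ∃ B : Set (Y × Y), B.Nonempty ∧ ∀ p ∈ B, p.1 ≠ p.2 ∧ ∃ w, malcevStep p w ∈ B := by
  have := finite_withOne (S := Y)
  let C : ℕ → Set (Y × Y) := fun n =>
    {p | ∃ w, (malcevPair p.1 p.2 w n).1 ≠ (malcevPair p.1 p.2 w n).2}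
  have hC : Antitone C := by
    apply antitone_nat_of_succ_le
    rintro n p ⟨w, hw⟩
    refine ⟨w, fun e => hw ?_⟩
    rw [malcevPair_succ, malcevStep, e]
  have hne : ∀ n, (C n).Nonempty := by
    intro n
    -- Nilpotency asks for a positive index, hence the shift.
    have h1 : (C (n + 1)).Nonempty := by
      by_contra hn
      refine h ⟨n + 1, n.succ_pos, fun a b w => ?_⟩
      by_contra hab
      exact hn ⟨(a, b), w, hab⟩
    exact h1.mono (hC n.le_succ)
  refine ⟨{p | ∀ n, p ∈ C n}, exists_forall_mem_of_antitone C hC hne, fun p hp => ⟨?_, ?_⟩⟩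
  · obtain ⟨w, hw⟩ := hp 0
    exact hw
  · refine exists_forall_mem_of_antitone (fun n => {w | malcevStep p w ∈ C n})
      (fun m n hmn w hw => hC hmn hw) (fun n => ?_)
    obtain ⟨w, hw⟩ := hp (n + 1)
    rw [malcevPair_succ'] at hw
    exact ⟨w 0, _, hw⟩

end Nilpotency

/-! ### From graphs of Rees quotients to the monoid with adjoined identity -/

section Transfer

variable {S T Y : Type*} [Semigroup S] [Semigroup T] [Semigroup Y]

theorem withOne_mul_eq_one {a b : WithOne S} (h : a * b = 1) : a = 1 := by
  induction a using WithOne.recOneCoe with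
  | one => rfl
  | coe a =>
    induction b using WithOne.recOneCoe with
    | one => exact h
    | coe b => exact absurd h (by rw [← WithOne.coe_mul]; exact WithOne.coe_ne_one)

/-- The complement of `A` in `S¹`. -/
def outside (A : Set S) : Set (WithOne S) := {m | ∀ s ∈ A, m ≠ s}

omit [Semigroup S] in
theorem coe_mem_outside {A : Set S} {s : S} : (s : WithOne S) ∈ outside A ↔ s ∉ A :=
  ⟨fun h hs => h s hs rfl, fun h _ ht e => h (WithOne.coe_inj.1 e ▸ ht)⟩

/-- The maps j and π are separate so that one proof serves S, its Rees quotients, and Rees quotients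
of subsemigroups. Lifted pairs avoid A: one coordinate in A would put both successors in A, where π
identifies them. -/
theorem adj_iff_nonNil [Finite Y] (j : T →ₙ* S) (hj : Function.Injective j) (π : T →ₙ* Y)
    {A : Set S} (hA : IsIdeal A) (hπ : ∀ c d, π c = π d ↔ c = d ∨ (j c ∈ A ∧ j d ∈ A)) (a b : T) :
    (upperGraph Y).Adj (π a) (π b) ↔
      NonNil (outside A) (j a : WithOne S) (j b : WithOne S) := by
  set U := Submonoid.closure {(j a : WithOne S), (j b : WithOne S)} with hU
  set V := Subsemigroup.closure {π a, π b} with hV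
  have F1 : ∀ m ∈ U, m = 1 ∨ ∃ t : T, m = (j t : WithOne S) ∧ π t ∈ V := by
    intro m hm
    induction hm using Submonoid.closure_induction with
    | mem x hx =>
      rcases hx with rfl | hx
      · exact Or.inr ⟨a, rfl, Subsemigroup.subset_closure (Or.inl rfl)⟩
      · exact Or.inr ⟨b, hx, Subsemigroup.subset_closure (Or.inr rfl)⟩
    | one => exact Or.inl rfl
    | mul x y _ _ hx hy =>
      rcases hx with rfl | ⟨s, rfl, hs⟩
      · rw [one_mul]; exact hy
      · rcases hy with rfl | ⟨t, rfl, ht⟩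
        · rw [mul_one]; exact Or.inr ⟨s, rfl, hs⟩
        · exact Or.inr ⟨s * t, by rw [map_mul, WithOne.coe_mul], by rw [map_mul]; exact mul_mem hs ht⟩
  have F2 : ∀ v ∈ V, ∃ t, π t = v ∧ (j t : WithOne S) ∈ U := by
    intro v hv
    induction hv using Subsemigroup.closure_induction with
    | mem x hx =>
      rcases hx with rfl | hx
      · exact ⟨a, rfl, Submonoid.subset_closure (Or.inl rfl)⟩
      · exact ⟨b, (Set.mem_singleton_iff.1 hx).symm, Submonoid.subset_closure (Or.inr rfl)⟩
    | mul x y _ _ hx hy =>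
      obtain ⟨s, rfl, hs⟩ := hx
      obtain ⟨t, rfl, ht⟩ := hy
      exact ⟨s * t, map_mul _ _ _, by rw [map_mul, WithOne.coe_mul]; exact mul_mem hs ht⟩
  constructor
  · intro h
    obtain ⟨B, ⟨⟨v1, v2⟩, hq⟩, hB⟩ := exists_set_of_not_malcevNilpotent h
    let B' : Set (T × T) := {p | (j p.1 : WithOne S) ∈ U ∧ (j p.2 : WithOne S) ∈ U ∧
      ∃ (h1 : π p.1 ∈ V) (h2 : π p.2 ∈ V), (⟨π p.1, h1⟩, ⟨π p.2, h2⟩) ∈ B}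
    have hstep : ∀ p ∈ B', ∃ w ∈ U, ∃ p' ∈ B', (j p.1 * w * j p.2 : WithOne S) = j p'.1 ∧
        (j p.2 * w * j p.1 : WithOne S) = j p'.2 := by
      rintro ⟨c, d⟩ ⟨hc, hd, hc', hd', hcd⟩
      dsimp only at hc hd hc' hd' hcd
      obtain ⟨w, hw⟩ := (hB _ hcd).2
      induction w using WithOne.recOneCoe with
      | one =>
        have e1 : π (c * d) = π c * π d := map_mul _ _ _
        have e2 : π (d * c) = π d * π c := map_mul _ _ _
        refine ⟨1, one_mem _, (c * d, d * c), ⟨?_, ?_, ?_, ?_, ?_⟩, by simp, by simp⟩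
        · simpa using mul_mem hc hd
        · simpa using mul_mem hd hc
        · rw [e1]; exact mul_mem hc' hd'
        · rw [e2]; exact mul_mem hd' hc'
        · convert hw using 1
          exact Prod.ext (Subtype.ext e1) (Subtype.ext e2)
      | coe v =>
        obtain ⟨t, ht, htU⟩ := F2 v v.2
        have e1 : π (c * t * d) = π c * v * π d := by rw [map_mul, map_mul, ht]
        have e2 : π (d * t * c) = π d * v * π c := by rw [map_mul, map_mul, ht]
        refine ⟨j t, htU, (c * t * d, d * t * c), ⟨?_, ?_, ?_, ?_, ?_⟩, by simp, by simp⟩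
        · simpa using mul_mem (mul_mem hc htU) hd
        · simpa using mul_mem (mul_mem hd htU) hc
        · rw [e1]; exact mul_mem (mul_mem hc' v.2) hd'
        · rw [e2]; exact mul_mem (mul_mem hd' v.2) hc'
        · convert hw using 1
          exact Prod.ext (Subtype.ext e1) (Subtype.ext e2)
    have hne : ∀ p ∈ B', π p.1 ≠ π p.2 := by
      rintro p ⟨-, -, h1, h2, h3⟩ e
      exact (hB _ h3).1 (Subtype.ext e)
    have hmulA : ∀ (c d : S) (w : WithOne S) (e : S), c ∈ A ∨ d ∈ A →
        (c * w * d : WithOne S) = e → e ∈ A := by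
      intro c d w e hcd h
      rw [← coe_sandwich] at h
      rw [← WithOne.coe_inj.1 h]
      induction w using WithOne.recOneCoe with
      | one =>
        rcases hcd with h | h
        · exact (hA _ h d).2
        · exact (hA _ h c).1
      | coe t =>
        rcases hcd with h | h
        · exact (hA _ (hA _ h t).2 d).2
        · exact (hA _ h (c * t)).1
    have hnA : ∀ p ∈ B', ¬ (j p.1 ∈ A ∨ j p.2 ∈ A) := by
      intro p hp hor
      obtain ⟨w, -, p', hp', e1, e2⟩ := hstep p hp
      exact hne p' hp' ((hπ _ _).2 (Or.inr ⟨hmulA _ _ _ _ hor e1, hmulA _ _ _ _ hor.symm e2⟩))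
    obtain ⟨c, hc, hcU⟩ := F2 v1 v1.2
    obtain ⟨d, hd, hdU⟩ := F2 v2 v2.2
    refine ⟨(fun p : T × T => ((j p.1 : WithOne S), (j p.2 : WithOne S))) '' B',
      ⟨_, (c, d), ⟨hcU, hdU, hc ▸ v1.2, hd ▸ v2.2, ?_⟩, rfl⟩, ?_, ?_⟩
    · convert hq using 1
      exact Prod.ext (Subtype.ext hc) (Subtype.ext hd)
    · rintro _ ⟨p, hp, rfl⟩
      exact ⟨hp.1, hp.2.1⟩
    · constructor
      · rintro _ ⟨p, hp, rfl⟩ e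
        exact hne p hp (congrArg π (hj (WithOne.coe_inj.1 e)))
      · rintro _ ⟨p, hp, rfl⟩
        exact coe_mem_outside.2 fun h => hnA p hp (Or.inl h)
      · rintro _ ⟨p, hp, rfl⟩
        exact coe_mem_outside.2 fun h => hnA p hp (Or.inr h)
      · rintro _ ⟨p, hp, rfl⟩
        obtain ⟨w, hw, p', hp', e1, e2⟩ := hstep p hp
        exact ⟨w, hw, p', hp', Prod.ext e1.symm e2.symm⟩
  · rintro ⟨B, ⟨q, hq⟩, hcl, hB⟩
    have hdec : ∀ p ∈ B, p.1 ≠ 1 → p.2 ≠ 1 → ∃ c d : T, p = ((j c : WithOne S), (j d : WithOne S)) ∧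
        π c ∈ V ∧ π d ∈ V := by
      intro p hp h1 h2
      obtain ⟨c, hc, hc'⟩ := (F1 _ (hcl p hp).1).resolve_left h1
      obtain ⟨d, hd, hd'⟩ := (F1 _ (hcl p hp).2).resolve_left h2
      exact ⟨c, d, Prod.ext hc hd, hc', hd'⟩
    -- A pair may contain the adjoined 1, but its successor cannot, since a product equals 1 only if
    -- all its factors do.
    have hnext : ∀ p ∈ B, ∃ w ∈ U, ∃ c d : T, (p.1 * w * p.2, p.2 * w * p.1) ∈ B ∧
        p.1 * w * p.2 = (j c : WithOne S) ∧ p.2 * w * p.1 = (j d : WithOne S) ∧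
        π c ∈ V ∧ π d ∈ V := by
      intro p hp
      obtain ⟨w, hw, hs⟩ := hB.step p hp
      have hone : ∀ x y : WithOne S, x ≠ y → x * w * y ≠ 1 := by
        intro x y hxy e
        have e1 := withOne_mul_eq_one e
        rw [e1, one_mul] at e
        exact hxy ((withOne_mul_eq_one e1).trans e.symm)
      obtain ⟨c, d, h1, h2, h3⟩ := hdec _ hs (hone _ _ (hB.ne p hp)) (hone _ _ (hB.ne p hp).symm)
      exact ⟨w, hw, c, d, hs, congrArg Prod.fst h1, congrArg Prod.snd h1, h2, h3⟩
    refine not_malcevNilpotent_of_set (B := {p : V × V | ∃ c d : T, π c = p.1 ∧ π d = p.2 ∧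
      ((j c : WithOne S), (j d : WithOne S)) ∈ B}) ?_ ?_
    · obtain ⟨w, -, c, d, hs, h1, h2, h3, h4⟩ := hnext q hq
      exact ⟨(⟨π c, h3⟩, ⟨π d, h4⟩), c, d, rfl, rfl, by rw [← h1, ← h2]; exact hs⟩
    · rintro ⟨v1, v2⟩ ⟨c, d, h1, h2, hcd⟩
      dsimp only at h1 h2
      refine ⟨fun e => ?_, ?_⟩
      · have e' : π c = π d := by rw [h1, h2]; exact congrArg Subtype.val e
        rcases (hπ _ _).1 e' with rfl | ⟨h3, -⟩
        · exact hB.ne _ hcd rfl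
        · exact coe_mem_outside.1 (hB.left _ hcd) h3
      · obtain ⟨w, hw, c', d', hs, e1, e2, hc', hd'⟩ := hnext _ hcd
        dsimp only at e1 e2 hs
        rw [e1, e2] at hs
        rcases F1 w hw with rfl | ⟨t, rfl, ht⟩
        · rw [mul_one, ← WithOne.coe_mul, WithOne.coe_inj, ← map_mul] at e1 e2
          exact ⟨1, c', d', by rw [← hj e1, map_mul, h1, h2]; rfl,
            by rw [← hj e2, map_mul, h1, h2]; rfl, hs⟩
        · rw [← WithOne.coe_mul, ← WithOne.coe_mul, WithOne.coe_inj, ← map_mul, ← map_mul] at e1 e2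
          exact ⟨((⟨π t, ht⟩ : V) : WithOne V), c', d',
            by rw [← hj e1, map_mul, map_mul, h1, h2]; rfl,
            by rw [← hj e2, map_mul, map_mul, h1, h2]; rfl, hs⟩

variable [Finite S]

theorem finite_reesQuotient {A : Set S} (hA : IsIdeal A) : Finite (ReesQuotient A hA) :=
  Quotient.finite _

theorem upperGraph_adj_iff {a b : S} :
    (upperGraph S).Adj a b ↔ NonNil Set.univ (a : WithOne S) (b : WithOne S) := by
  have h := adj_iff_nonNil (MulHom.id S) Function.injective_id (MulHom.id S) (A := (∅ : Set S))
    (fun a ha => ha.elim) (by simp) a b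
  have he : outside (∅ : Set S) = Set.univ := by ext; simp [outside]
  rw [he] at h
  exact h

omit [Finite S] in
theorem reesMk_eq_iff {A : Set S} (hA : IsIdeal A) {a b : S} :
    reesMk A hA a = reesMk A hA b ↔ a = b ∨ (a ∈ A ∧ b ∈ A) :=
  (reesCon A hA).eq

theorem upperGraph_rees_adj_iff {A : Set S} (hA : IsIdeal A) {a b : S} :
    (upperGraph (ReesQuotient A hA)).Adj (reesMk A hA a) (reesMk A hA b) ↔
      NonNil (outside A) (a : WithOne S) (b : WithOne S) := by
  have := finite_reesQuotient hA
  exact adj_iff_nonNil (MulHom.id S) Function.injective_id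
    (⟨reesMk A hA, fun _ _ => rfl⟩ : S →ₙ* ReesQuotient A hA) hA
    (fun c d => reesMk_eq_iff hA) a b

theorem upperGraph_sub_rees_adj_iff {A : Set S} (hA : IsIdeal A) (T : Subsemigroup S) {a b : T} :
    (upperGraph (ReesQuotient _ (hA.preimage T))).Adj (reesMk _ (hA.preimage T) a)
      (reesMk _ (hA.preimage T) b) ↔
      NonNil (outside A) ((a : S) : WithOne S) ((b : S) : WithOne S) := by
  have := finite_reesQuotient (hA.preimage T)
  exact adj_iff_nonNil (MulMemClass.subtype T) Subtype.val_injective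
    (⟨reesMk _ (hA.preimage T), fun _ _ => rfl⟩ : T →ₙ* ReesQuotient _ (hA.preimage T)) hA
    (fun c d => reesMk_eq_iff (hA.preimage T)) a b

omit [Finite S] in
theorem isIdeal_not_jLE (z : WithOne S) : IsIdeal {s : S | ¬ JLE z (s : WithOne S)} := by
  intro a ha s
  exact ⟨fun h => ha (by rw [WithOne.coe_mul] at h; exact h.of_mul_right),
    fun h => ha (by rw [WithOne.coe_mul] at h; exact h.of_mul_left)⟩

omit [Finite S] in
theorem outside_not_jLE (z : WithOne S) :
    outside {s : S | ¬ JLE z (s : WithOne S)} = {m | JLE z m} := by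
  ext m
  induction m using WithOne.recOneCoe with
  | one => exact ⟨fun _ => JLE.one z, fun _ s _ h => WithOne.coe_ne_one h.symm⟩
  | coe s => rw [coe_mem_outside]; simp

/-- Follow an infinite Mal'cev sequence inside B; by finiteness it repeats. Pseudo-nilpotence,
applied modulo the ideal of elements not above z and read at index 0, is the claim about the initial
pair. -/
theorem isPN_withOne (hS : IsPseudoNilpotent S) : IsPN (WithOne S) where
  unit _ _ := withOne_mul_eq_one
  nonNil z a b B ha hb hB hab := by
    obtain ⟨x, rfl⟩ := WithOne.ne_one_iff_exists.1 ha
    obtain ⟨y, rfl⟩ := WithOne.ne_one_iff_exists.1 hb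
    have hstep : ∀ p ∈ {p : S × S | ((p.1 : WithOne S), (p.2 : WithOne S)) ∈ B},
        ∃ w, malcevStep p w ∈ {p : S × S | ((p.1 : WithOne S), (p.2 : WithOne S)) ∈ B} := by
      intro p hp
      obtain ⟨w, -, hw⟩ := hB.step _ hp
      refine ⟨w, ?_⟩
      simp only [Set.mem_ofPred_eq, malcevStep, coe_sandwich]
      exact hw
    obtain ⟨w, hw⟩ := exists_malcevPair_mem hstep (p := (x, y)) hab
    obtain ⟨t, m, htm, he⟩ := Finite.exists_ne_map_eq_of_infinite (malcevPair x y w)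
    wlog hlt : t < m generalizing t m
    · exact this m t htm.symm he.symm (by omega)
    have hA := isIdeal_not_jLE (S := S) z
    have := hS x y w t m hlt (fun e => hB.ne _ (hw t) (congrArg _ e)) he _
      (hA.preimage (malcevSpan x y w m)) (fun h => h (hB.left _ (hw m)))
      (fun h => h (hB.right _ (hw m))) 0 m.zero_le
    rw [upperGraph_sub_rees_adj_iff hA, outside_not_jLE] at this
    exact this

end Transfer

universe u

/-! ### Big J-classes -/

section Graph

variable {M : Type*} [Monoid M] [Finite M]

omit [Finite M] in
theorem IsFull.congr {z z' : M} (h : JEq z z') (hf : IsFull z) : IsFull z' :=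
  fun a b ha hb => h.2.trans (hf a b (h.trans ha) (h.trans hb))

omit [Finite M] in
theorem IsBig.congr {z z' : M} (h : JEq z z') (hz : IsBig z) : IsBig z' := by
  obtain ⟨hf, a, b, ha, hb, hab⟩ := hz
  exact ⟨hf.congr h, a, b, h.symm.trans ha, h.symm.trans hb, hab⟩

theorem IsPN.sameCls_congr (hM : IsPN M) {z z' x y : M} (hf : IsFull z) (h : JEq z z')
    (hx1 : x ≠ 1) (hy1 : y ≠ 1) (hx : JLE z x) (hy : JLE z y) (hs : SameCls z x y) :
    SameCls z' x y :=
  ⟨((hM.rEq_mul hf hx1 hx h (.refl z)).trans hs.1).trans (hM.rEq_mul hf hy1 hy (.refl z) h),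
    ((hM.lEq_mul hf hx1 hx h (.refl z)).trans hs.2).trans (hM.lEq_mul hf hy1 hy (.refl z) h)⟩

/-- The H-class that a determines is that of aza, because az R aza L za. -/
theorem IsFull.sameCls_iff_mid {z a b : M} (hf : IsFull z) (ha : JLE z a) (hb : JEq z b) :
    SameCls z a b ↔ REq (a * z * a) b ∧ LEq (a * z * a) b := by
  have hz := JEq.refl z
  have h1 : REq (a * z) (a * z * a) := hf.rEq_mul ha (hf.jEq_mul_left ha hz)
  have h2 : LEq (z * a) (a * z * a) := by
    rw [mul_assoc]
    exact hf.lEq_mul ha (hf.jEq_mul_right ha hz)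
  have h3 := hf.rEq_mul (JLE.refl z) hb
  have h4 := hf.lEq_mul (JLE.refl z) hb
  exact ⟨fun h => ⟨(h1.symm.trans h.1).trans h3.symm, (h2.symm.trans h.2).trans h4.symm⟩,
    fun h => ⟨(h1.trans h.1).trans h3, (h2.trans h.2).trans h4⟩⟩

theorem IsBig.exists_not_sameCls {z x : M} (h : IsBig z) : ∃ a, JEq z a ∧ ¬ SameCls z x a := by
  obtain ⟨hf, p, q, hp, hq, hpq⟩ := h
  by_contra! hall
  exact hpq ((hf.sameCls_iff hp hq).1 ((hall p hp).symm.trans (hall q hq)))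

omit [Finite M] in
theorem IsPN.not_isBig_one (hM : IsPN M) : ¬ IsBig (1 : M) := by
  rintro ⟨-, a, b, ha, hb, hab⟩
  rw [hM.eq_one_of_jLE ha.1, hM.eq_one_of_jLE hb.1] at hab
  exact hab ⟨.refl _, .refl _⟩

end Graph

/-! ### Edges, isolated vertices and connectedness through big J-classes -/

section Edges

variable {S : Type*} [Semigroup S]

theorem IsIdeal.mem_of_jLE {A : Set S} (hA : IsIdeal A) {s t : S} (hs : s ∈ A)
    (h : JLE (t : WithOne S) s) : t ∈ A := by
  obtain ⟨u, v, h⟩ := h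
  induction u using WithOne.recOneCoe with
  | one =>
    induction v using WithOne.recOneCoe with
    | one =>
      rw [one_mul, mul_one, WithOne.coe_inj] at h
      exact h ▸ hs
    | coe v =>
      rw [one_mul, ← WithOne.coe_mul, WithOne.coe_inj] at h
      exact h ▸ (hA s hs v).2
  | coe u =>
    induction v using WithOne.recOneCoe with
    | one =>
      rw [mul_one, ← WithOne.coe_mul, WithOne.coe_inj] at h
      exact h ▸ (hA s hs u).1
    | coe v =>
      rw [← WithOne.coe_mul, ← WithOne.coe_mul, WithOne.coe_inj] at h
      exact h ▸ (hA _ (hA s hs u).1 v).2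

variable [Finite S]

omit [Finite S] in
theorem IsPN.exists_coe_of_isBig (hM : IsPN (WithOne S)) {z : WithOne S} (hz : IsBig z) :
    ∃ s : S, (s : WithOne S) = z :=
  WithOne.ne_one_iff_exists.1 fun h => hM.not_isBig_one (h ▸ hz)

omit [Finite S] in
theorem IsPN.exists_coe_of_jEq (hM : IsPN (WithOne S)) {z : S} {a : WithOne S} (h : JEq ↑z a) :
    ∃ s : S, (s : WithOne S) = a :=
  WithOne.ne_one_iff_exists.1 fun h1 =>
    WithOne.coe_ne_one (hM.eq_one_of_jLE (h1 ▸ h.2 : JLE 1 (z : WithOne S)))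

theorem IsPN.adj_iff (hM : IsPN (WithOne S)) {a b : S} :
    (upperGraph S).Adj a b ↔ ∃ z : S, IsBig (z : WithOne S) ∧ JLE (z : WithOne S) a ∧
      JLE (z : WithOne S) b ∧ ¬ SameCls (z : WithOne S) a b := by
  have := finite_withOne (S := S)
  rw [upperGraph_adj_iff]
  constructor
  · intro h
    obtain ⟨z, -, hz, h⟩ := hM.exists_isBig_of_nonNil WithOne.coe_ne_one WithOne.coe_ne_one h
    obtain ⟨z, rfl⟩ := hM.exists_coe_of_isBig hz
    exact ⟨z, hz, h⟩
  · rintro ⟨z, hz, ha, hb, hn⟩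
    exact (hM.nonNil_of_isFull hz.1 WithOne.coe_ne_one WithOne.coe_ne_one ha hb hn).mono
      (Set.subset_univ _)

/-- Passing to the Rees quotient merely discards the big J-classes inside A as witnesses of an edge.
-/
theorem IsPN.rees_adj_iff (hM : IsPN (WithOne S)) {A : Set S} (hA : IsIdeal A) {a b : S} :
    (upperGraph (ReesQuotient A hA)).Adj (reesMk A hA a) (reesMk A hA b) ↔
      ∃ z : S, z ∉ A ∧ IsBig (z : WithOne S) ∧ JLE (z : WithOne S) a ∧ JLE (z : WithOne S) b ∧
        ¬ SameCls (z : WithOne S) a b := by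
  have := finite_withOne (S := S)
  rw [upperGraph_rees_adj_iff]
  constructor
  · intro h
    obtain ⟨z, hzA, hz, h⟩ := hM.exists_isBig_of_nonNil WithOne.coe_ne_one WithOne.coe_ne_one h
    obtain ⟨z, rfl⟩ := hM.exists_coe_of_isBig hz
    exact ⟨z, coe_mem_outside.1 hzA, hz, h⟩
  · rintro ⟨z, hzA, hz, ha, hb, hn⟩
    refine (hM.nonNil_of_isFull hz.1 WithOne.coe_ne_one WithOne.coe_ne_one ha hb hn).mono ?_
    rintro m hm s hs rfl
    exact hzA (hA.mem_of_jLE hs hm)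

theorem IsPN.not_mem_isolatedSet_iff (hM : IsPN (WithOne S)) {x : S} :
    x ∉ isolatedSet S ↔ ∃ z : S, IsBig (z : WithOne S) ∧ JLE (z : WithOne S) x := by
  have := finite_withOne (S := S)
  have hiff : x ∉ isolatedSet S ↔ ∃ y, (upperGraph S).Adj x y := by
    simp [isolatedSet, SimpleGraph.IsIsolated]
  rw [hiff]
  constructor
  · rintro ⟨y, hy⟩
    obtain ⟨z, hz, hx, -⟩ := hM.adj_iff.1 hy
    exact ⟨z, hz, hx⟩
  · rintro ⟨z, hz, hx⟩
    obtain ⟨a, ha, hn⟩ := hz.exists_not_sameCls (x := (x : WithOne S))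
    obtain ⟨a, rfl⟩ := hM.exists_coe_of_jEq ha
    exact ⟨a, hM.adj_iff.2 ⟨z, hz, hx, ha.1, hn⟩⟩

/-- If x and y determine the same H-class, an element of another H-class is adjacent to both. -/
theorem IsPN.reachable_of_jLE (hM : IsPN (WithOne S)) {z x y : S} (hz : IsBig (z : WithOne S))
    (hx : JLE (z : WithOne S) x) (hy : JLE (z : WithOne S) y) : (upperGraph S).Reachable x y := by
  have := finite_withOne (S := S)
  by_cases h : SameCls (z : WithOne S) x y
  · obtain ⟨a, ha, hn⟩ := hz.exists_not_sameCls (x := (x : WithOne S))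
    obtain ⟨a, rfl⟩ := hM.exists_coe_of_jEq ha
    have h1 : (upperGraph S).Adj x a := hM.adj_iff.2 ⟨z, hz, hx, ha.1, hn⟩
    have h2 : (upperGraph S).Adj y a :=
      hM.adj_iff.2 ⟨z, hz, hy, ha.1, fun h' => hn (h.trans h')⟩
    exact h1.reachable.trans h2.symm.reachable
  · exact SimpleGraph.Adj.reachable (hM.adj_iff.2 ⟨z, hz, hx, hy, h⟩)

/-- A big `J`-class below which there is no other one. -/
def IsMinBig (z : S) : Prop :=
  IsBig (z : WithOne S) ∧ ∀ z' : S, IsBig (z' : WithOne S) → JLE (z' : WithOne S) z →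
    JLE (z : WithOne S) z'

theorem exists_isMinBig {z : S} (hz : IsBig (z : WithOne S)) :
    ∃ z' : S, IsMinBig z' ∧ JLE (z' : WithOne S) z := by
  have := finite_withOne (S := S)
  obtain ⟨p, ⟨hp, hpz⟩, hmin⟩ := (measure (fun p : S => {s : WithOne S | JLE s p}.ncard)).wf.has_min
    {p : S | IsBig (p : WithOne S) ∧ JLE (p : WithOne S) z} ⟨z, hz, .refl _⟩
  refine ⟨p, ⟨hp, fun q hq hqp => ?_⟩, hpz⟩
  by_contra hn
  apply hmin q ⟨hq, hqp.trans hpz⟩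
  apply Set.ncard_lt_ncard _ (Set.toFinite _)
  exact ⟨fun s hs => JLE.trans hs hqp, fun hsub => hn (hsub (JLE.refl (p : WithOne S)))⟩

end Edges

/-! ### Layers, stems and roots in terms of J-classes -/

section Layers

variable {S : Type u} [Semigroup S] (Q : PrincipalSeries S)

namespace PrincipalSeries

/-- The principal ideal of s together with the lower term lies between two consecutive terms of the
series, so it is the upper one. -/
theorem jEq_of_mem_layer {i : Fin Q.length} {z s : S} (hz : z ∈ Q.layer i) (hs : s ∈ Q.layer i) :
    JEq (z : WithOne S) s := by
  have key : ∀ z ∈ Q.layer i, ∀ s ∈ Q.layer i, JLE (z : WithOne S) s := by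
    intro z hz s hs
    have hA : IsIdeal ({t : S | JLE (t : WithOne S) s} ∪ Q.lower i) := by
      rintro a (ha | ha) t
      · exact ⟨Or.inl ((JLE.mul_left (t : WithOne S) a).trans ha),
          Or.inl ((JLE.mul_right (a : WithOne S) t).trans ha)⟩
      · exact ⟨Or.inr (Q.lower_isIdeal i a ha t).1, Or.inr (Q.lower_isIdeal i a ha t).2⟩
    have hsub : {t : S | JLE (t : WithOne S) s} ∪ Q.lower i ⊆ Q.upper i := by
      rintro t (ht | ht)
      · exact (Q.upper_isIdeal i).mem_of_jLE hs.1 ht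
      · exact (Q.strict i).1 ht
    rcases Q.no_between i _ hA Set.subset_union_right hsub with h | h
    · exact absurd (h ▸ Or.inl (JLE.refl _) : s ∈ Q.ideal i.succ) hs.2
    · have : z ∈ Q.ideal i.castSucc := hz.1
      rw [← h] at this
      exact this.resolve_right hz.2
  exact ⟨key z hz s hs, key s hs z hz⟩

theorem mem_layer_of_jEq {i : Fin Q.length} {z s : S} (hz : z ∈ Q.layer i)
    (h : JEq (z : WithOne S) s) : s ∈ Q.layer i :=
  ⟨(Q.upper_isIdeal i).mem_of_jLE hz.1 h.2,
    fun hs => hz.2 ((Q.lower_isIdeal i).mem_of_jLE hs h.1)⟩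

theorem exists_mem_layer (s : S) : ∃ i, s ∈ Q.layer i := by
  by_contra! h
  have h1 : ∀ k, s ∈ Q.ideal k := by
    intro k
    induction k using Fin.induction with
    | zero => rw [Q.first_eq]; trivial
    | succ i ih =>
      by_contra hn
      exact h i ⟨ih, hn⟩
  have h2 := h1 (Fin.last _)
  rw [Q.last_eq] at h2
  exact h2

theorem upper_subset_lower {i j : Fin Q.length} (h : i < j) : Q.upper j ⊆ Q.lower i := by
  have hanti : Antitone Q.ideal := Fin.antitone_iff_succ_le.2 fun i => (Q.strict i).1
  exact hanti (Fin.succ_le_castSucc_iff.2 h)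

theorem exists_mul_of_mem_annFree {i : Fin Q.length} {s : S} (hs : s ∈ Q.annFree i) :
    ∃ t ∈ Q.layer i, JLE (t : WithOne S) s := by
  obtain ⟨-, j, hj, h | h⟩ := hs
  · exact ⟨s * j, ⟨(Q.upper_isIdeal i j hj s).1, h⟩, JLE.mul_right (s : WithOne S) j⟩
  · exact ⟨j * s, ⟨(Q.upper_isIdeal i j hj s).2, h⟩, JLE.mul_left (j : WithOne S) s⟩

theorem mem_annFree_union_layer_iff {i : Fin Q.length} {z s : S} (hz : z ∈ Q.layer i)
    (hf : IsFull (z : WithOne S)) : s ∈ Q.annFree i ∪ Q.layer i ↔ JLE (z : WithOne S) s := by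
  constructor
  · rintro (h | h)
    · obtain ⟨t, ht, hts⟩ := Q.exists_mul_of_mem_annFree h
      exact (Q.jEq_of_mem_layer hz ht).1.trans hts
    · exact (Q.jEq_of_mem_layer hz h).1
  · intro h
    by_cases hs : s ∈ Q.upper i
    · exact Or.inr ⟨hs, fun hl => hz.2 ((Q.lower_isIdeal i).mem_of_jLE hl h)⟩
    · exact Or.inl ⟨hs, z, hz.1, Or.inl (Q.mem_layer_of_jEq hz (s := s * z)
        (by rw [WithOne.coe_mul]; exact hf.jEq_mul_left h (.refl _))).2⟩

theorem mem_stem_iff {i : Fin Q.length} {z s : S} (hz : z ∈ Q.layer i)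
    (hf : IsFull (z : WithOne S)) : s ∈ Q.stem i ↔ JLE (z : WithOne S) s := by
  have hmem : s ∈ Q.stem i ↔
      ∃ j, (j ≤ i ∧ Q.layer j ⊆ Q.annFree i ∪ Q.layer i) ∧ s ∈ Q.layer j := by
    simp [stem]
  rw [hmem]
  constructor
  · rintro ⟨j, ⟨-, hj⟩, hs⟩
    exact (Q.mem_annFree_union_layer_iff hz hf).1 (hj hs)
  · intro h
    obtain ⟨j, hj⟩ := Q.exists_mem_layer s
    refine ⟨j, ⟨?_, fun t ht => (Q.mem_annFree_union_layer_iff hz hf).2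
      (h.trans (Q.jEq_of_mem_layer hj ht).1)⟩, hj⟩
    by_contra hn
    exact hz.2 ((Q.lower_isIdeal i).mem_of_jLE (Q.upper_subset_lower (not_le.1 hn) hj.1) h)

variable [Finite S]

/-- Pairs with different H-classes persist with parameter 1: cd lies in the R-class of c and the
L-class of d, and dc the other way round. -/
theorem not_malcevNilpotent_factor {i : Fin Q.length} {z : S} (hz : z ∈ Q.layer i)
    (hbig : IsBig (z : WithOne S)) (hM : IsPN (WithOne S)) :
    ¬ MalcevNilpotent (Q.Factor i) := by
  have := finite_withOne (S := S)
  obtain ⟨hf, p, q, hp, hq, hpq⟩ := hbig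
  obtain ⟨p, rfl⟩ := hM.exists_coe_of_jEq hp
  obtain ⟨q, rfl⟩ := hM.exists_coe_of_jEq hq
  have hI := (Q.lower_isIdeal i).preimage (Q.upper_isIdeal i).toSubsemigroup
  let C : Set ((Q.upper_isIdeal i).toSubsemigroup × (Q.upper_isIdeal i).toSubsemigroup) :=
    {r | JEq (z : WithOne S) (r.1 : S) ∧ JEq (z : WithOne S) (r.2 : S) ∧
      ¬ (REq ((r.1 : S) : WithOne S) (r.2 : S) ∧ LEq ((r.1 : S) : WithOne S) (r.2 : S))}
  refine not_malcevNilpotent_of_set (B := (fun r => (reesMk _ hI r.1, reesMk _ hI r.2)) '' C)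
    ⟨_, (⟨p, (Q.mem_layer_of_jEq hz hp).1⟩, ⟨q, (Q.mem_layer_of_jEq hz hq).1⟩),
      ⟨hp, hq, hpq⟩, rfl⟩ ?_
  rintro _ ⟨⟨c, d⟩, ⟨hc, hd, hcd⟩, rfl⟩
  dsimp only at hc hd hcd
  refine ⟨fun e => ?_, 1, (c * d, d * c), ⟨?_, ?_, ?_⟩, rfl⟩
  · rcases (reesMk_eq_iff hI).1 e with h | h
    · have h' : c = d := h
      rw [h'] at hcd
      exact hcd ⟨.refl _, .refl _⟩
    · exact (Q.mem_layer_of_jEq hz hc).2 h.1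
  · exact hf.jEq_mul_left hc.1 hd
  · exact hf.jEq_mul_left hd.1 hc
  · intro h
    exact hcd ⟨((hf.rEq_mul hd.1 hc).trans h.1).trans (hf.rEq_mul hc.1 hd).symm,
      ((hf.lEq_mul hd.1 hc).trans h.2.symm).trans (hf.lEq_mul hc.1 hd).symm⟩

theorem isRoot_of_isMinBig {i : Fin Q.length} {z : S} (hz : z ∈ Q.layer i)
    (hmin : IsMinBig z) (hM : IsPN (WithOne S)) : Q.IsRoot i := by
  refine ⟨Q.not_malcevNilpotent_factor hz hmin.1 hM, fun a ha b hb hadj => ?_⟩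
  obtain ⟨t, ht, hta, htb, -⟩ := hM.adj_iff.1 hadj
  exact hz.2 ((Q.lower_isIdeal i).mem_of_jLE hb
    ((hmin.2 t ht (hta.trans (Q.jEq_of_mem_layer ha hz).1)).trans htb))

end PrincipalSeries

end Layers

/-! ### Rees coordinates and the pseudo-nilpotent homomorphism -/

section Rees

variable {S : Type u} [Semigroup S] [Finite S]

/-- Rees coordinates on a full `J`-class. -/
theorem exists_reesMatrix {f : S} (hf : IsFull (f : WithOne S)) (hff : f * f = f) :
    ∃ (G I L : Type u) (_ : Group G) (P : L → I → G) (e : ReesMatrix P →ₙ* S),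
      Function.Injective e ∧ Set.range e = {s : S | JEq (f : WithOne S) s} ∧
      ∀ m m', (REq (e m : WithOne S) (e m') ↔ m.i = m'.i) ∧
        (LEq (e m : WithOne S) (e m') ↔ m.l = m'.l) := by
  have := finite_withOne (S := S)
  let C : Set S := {s | JEq (f : WithOne S) s}
  have hfC : f ∈ C := JEq.refl _
  have hC : ∀ {a b}, a ∈ C → b ∈ C → a * b ∈ C := by
    intro a b ha hb
    exact hf.jEq_mul_left ha.1 hb
  have hCR : ∀ {a b}, a ∈ C → b ∈ C → REq (a : WithOne S) (a * b : S) := by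
    intro a b ha hb
    exact hf.rEq_mul hb.1 ha
  have hCL : ∀ {a b}, a ∈ C → b ∈ C → LEq (b : WithOne S) (a * b : S) := by
    intro a b ha hb
    exact hf.lEq_mul ha.1 hb
  have hRmul : ∀ {a b c : S}, REq (a : WithOne S) b → c * b = b → c * a = a := by
    rintro a b c ⟨⟨u, hu⟩, -⟩ h
    apply WithOne.coe_injective
    rw [WithOne.coe_mul, hu, ← mul_assoc, ← WithOne.coe_mul, h]
  have hLmul : ∀ {a b c : S}, LEq (a : WithOne S) b → b * c = b → a * c = a := by
    rintro a b c ⟨⟨u, hu⟩, -⟩ h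
    apply WithOne.coe_injective
    rw [WithOne.coe_mul, hu, mul_assoc, ← WithOne.coe_mul, h]
  -- The group is the H-class of f.
  let G := {g : S // g ∈ C ∧ f * g = g ∧ g * f = g}
  have hinv : ∀ g : G, ∃ g' : G, g'.1 * g.1 = f := by
    rintro ⟨g, hg, hfg, hgf⟩
    have hL : LEq (f : WithOne S) g := by
      have := hCL hg hfC
      rwa [hgf] at this
    obtain ⟨⟨v, hv⟩, -⟩ := hL
    have key : sandwich f v f * g = f := by
      apply WithOne.coe_injective
      rw [WithOne.coe_mul, coe_sandwich, mul_assoc, ← WithOne.coe_mul f g, hfg, mul_assoc, ← hv,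
        ← WithOne.coe_mul, hff]
    refine ⟨⟨sandwich f v f, ⟨?_, ?_⟩, ?_, ?_⟩, key⟩
    · have h := JLE.mul_right ((sandwich f v f : S) : WithOne S) g
      rwa [← WithOne.coe_mul, key] at h
    · rw [coe_sandwich]
      exact JLE.mul_left _ _
    · apply WithOne.coe_injective
      rw [WithOne.coe_mul, coe_sandwich, ← mul_assoc, ← mul_assoc, ← WithOne.coe_mul f f, hff]
    · apply WithOne.coe_injective
      rw [WithOne.coe_mul, coe_sandwich, mul_assoc, ← WithOne.coe_mul f f, hff]
  choose inv hinv using hinv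
  let : Mul G := ⟨fun a b => ⟨a.1 * b.1, hC a.2.1 b.2.1, by rw [← mul_assoc, a.2.2.1],
    by rw [mul_assoc, b.2.2.2]⟩⟩
  let : One G := ⟨⟨f, hfC, hff, hff⟩⟩
  let : _root_.Inv G := ⟨inv⟩
  let hG : Group G := Group.ofLeftAxioms (fun a b c => Subtype.ext (mul_assoc _ _ _))
    (fun a => Subtype.ext a.2.2.1) (fun a => Subtype.ext (hinv a))
  -- These are the idempotents in the L-class of f, one for each R-class; dually, Λ below consists
  -- of the idempotents in the R-class of f.
  let I := {x : S // x ∈ C ∧ x * f = x ∧ f * x = f}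
  let Λ := {y : S // y ∈ C ∧ f * y = y ∧ y * f = f}
  let P : Λ → I → G := fun y x => ⟨y.1 * x.1, hC y.2.1 x.2.1, by rw [← mul_assoc, y.2.2.1],
    by rw [mul_assoc, x.2.2.1]⟩
  let e : ReesMatrix P →ₙ* S := ⟨fun m => m.i.1 * m.g.1 * m.l.1, fun m m' => by
    change m.i.1 * (m.g.1 * (m.l.1 * m'.i.1) * m'.g.1) * m'.l.1 = _
    simp only [mul_assoc]⟩
  have he : ∀ m, e m = m.i.1 * m.g.1 * m.l.1 := fun _ => rfl
  have heC : ∀ m, e m ∈ C := fun m => hC (hC m.i.2.1 m.g.2.1) m.l.2.1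
  have heR : ∀ m, REq (m.i.1 : WithOne S) (e m) := fun m => by
    rw [he, mul_assoc]
    exact hCR m.i.2.1 (hC m.g.2.1 m.l.2.1)
  have heL : ∀ m, LEq (m.l.1 : WithOne S) (e m) := fun m =>
    hCL (hC m.i.2.1 m.g.2.1) m.l.2.1
  have hR : ∀ m m', REq (e m : WithOne S) (e m') ↔ m.i = m'.i := by
    intro m m'
    constructor
    · intro h
      have h1 := ((heR m).trans h).trans (heR m').symm
      have h2 : m'.i.1 * m'.i.1 = m'.i.1 := by
        conv_lhs => rw [← m'.i.2.2.1, mul_assoc, m'.i.2.2.1, m'.i.2.2.2]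
        exact m'.i.2.2.1
      have h3 := hRmul h1 h2
      rw [← m'.i.2.2.1, mul_assoc, m.i.2.2.2, m'.i.2.2.1] at h3
      exact Subtype.ext h3.symm
    · intro h
      have := heR m
      rw [h] at this
      exact this.symm.trans (heR m')
  have hL : ∀ m m', LEq (e m : WithOne S) (e m') ↔ m.l = m'.l := by
    intro m m'
    constructor
    · intro h
      have h1 := ((heL m).trans h).trans (heL m').symm
      have h2 : m'.l.1 * m'.l.1 = m'.l.1 := by
        conv_lhs => rw [← m'.l.2.2.1, ← mul_assoc, m'.l.2.2.1, m'.l.2.2.2]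
        exact m'.l.2.2.1
      have h3 := hLmul h1 h2
      rw [← m'.l.2.2.1, ← mul_assoc, m.l.2.2.2, m'.l.2.2.1] at h3
      exact Subtype.ext h3.symm
    · intro h
      have := heL m
      rw [h] at this
      exact this.symm.trans (heL m')
  have hmid : ∀ m, f * e m * f = m.g.1 := by
    intro m
    rw [he, mul_assoc, mul_assoc _ m.l.1, m.l.2.2.2, mul_assoc m.i.1, m.g.2.2.2, ← mul_assoc,
      m.i.2.2.2, m.g.2.2.1]
  refine ⟨G, I, Λ, hG, P, e, ?_, ?_, fun m m' => ⟨hR m m', hL m m'⟩⟩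
  · intro m m' h
    have h1 := (hR m m').1 (h ▸ REq.refl _)
    have h2 := (hL m m').1 (h ▸ LEq.refl _)
    have h3 : m.g = m'.g := Subtype.ext (by rw [← hmid m, ← hmid m', h])
    exact ReesMatrix.ext h3 h1 h2
  · apply Set.Subset.antisymm
    · rintro _ ⟨m, rfl⟩
      exact heC m
    · intro a (ha : a ∈ C)
      -- The coordinates of a are g = faf, the row ag⁻¹ and the column g⁻¹a.
      let g : G := ⟨f * a * f, hC (hC hfC ha) hfC, by rw [← mul_assoc, ← mul_assoc, hff],
        by rw [mul_assoc, hff]⟩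
      obtain ⟨h, hh⟩ : ∃ h : G, h = g⁻¹ := ⟨_, rfl⟩
      have hgh : f * a * f * h.1 = f := by
        have : g * h = 1 := by rw [hh, mul_inv_cancel]
        exact congrArg Subtype.val this
      have hhg : h.1 * (f * a * f) = f := by
        have : h * g = 1 := by rw [hh, inv_mul_cancel]
        exact congrArg Subtype.val this
      have hfh := h.2.2.1
      have hhf := h.2.2.2
      have e1 : f * (a * h.1) = f := by
        rw [mul_assoc, hfh, mul_assoc] at hgh
        exact hgh
      have e2 : h.1 * a * f = f := by
        rw [← mul_assoc, ← mul_assoc, hhf] at hhg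
        exact hhg
      have e3 : a * h.1 * f = a * h.1 := by rw [mul_assoc, hhf]
      have e4 : f * (h.1 * a) = h.1 * a := by rw [← mul_assoc, hfh]
      have e5 : a * h.1 * (a * h.1) = a * h.1 := by
        calc a * h.1 * (a * h.1) = a * h.1 * f * (a * h.1) := by rw [e3]
          _ = a * h.1 := by rw [mul_assoc, e1, e3]
      have e6 : a * h.1 * a = a := hRmul (hCR ha h.2.1) e5
      refine ⟨⟨g, ⟨a * h.1, hC ha h.2.1, e3, e1⟩, ⟨h.1 * a, hC h.2.1 ha, e4, e2⟩⟩, ?_⟩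
      change a * h.1 * (f * a * f) * (h.1 * a) = a
      rw [mul_assoc a, hhg, mul_assoc, e4, ← mul_assoc, e6]

theorem IsFull.exists_idempotent {z : S} (hf : IsFull (z : WithOne S)) (hM : IsPN (WithOne S)) :
    ∃ f : S, f * f = f ∧ JEq (z : WithOne S) f := by
  have := finite_withOne (S := S)
  obtain ⟨n, hn, he⟩ := exists_pow_idempotent (z : WithOne S)
  have hJ : JEq (z : WithOne S) ((z : WithOne S) ^ n) := by
    rw [← Nat.sub_add_cancel hn, pow_succ']
    exact hf.jEq_mul_right (hf.jLE_pow (.refl _) _) (.refl _)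
  obtain ⟨f, hf'⟩ := hM.exists_coe_of_jEq hJ
  rw [← hf'] at he hJ
  exact ⟨f, WithOne.coe_injective he, hJ⟩

open Classical in
-- The condition speaks about arbitrary coordinates and an arbitrary Φ, so both must be produced.
-- The map sending a above f to the coordinates of afa works, and its fibres on the elements above f
-- are exactly the classes of `SameCls`.
theorem PrincipalSeries.MeetsTwoClasses.exists_not_sameCls {Q : PrincipalSeries S}
    {k i : Fin Q.length} (h : Q.MeetsTwoClasses k i) (hM : IsPN (WithOne S)) {z c : S}
    (hz : z ∈ Q.layer i) (hbig : IsBig (z : WithOne S)) (hc : c ∈ Q.layer k)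
    (hzc : JLE (z : WithOne S) c) :
    ∃ a ∈ Q.layer k, ∃ b ∈ Q.layer k, ¬ SameCls (z : WithOne S) a b := by
  have := finite_withOne (S := S)
  obtain ⟨f, hff, hzf⟩ := hbig.1.exists_idempotent hM
  have hfi := Q.mem_layer_of_jEq hz hzf
  have hfbig := hbig.congr hzf
  have hfull := hfbig.1
  obtain ⟨G, I, L, hG, P, e, hinj, hrange, hGreen⟩ := exists_reesMatrix hfull hff
  have hlayer : Set.range e = Q.layer i := by
    rw [hrange]
    exact Set.Subset.antisymm (fun s hs => Q.mem_layer_of_jEq hfi hs)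
      (fun s hs => Q.jEq_of_mem_layer hfi hs)
  have hmid : ∀ a : S, JLE (f : WithOne S) a → ∃ m, e m = a * f * a := by
    intro a ha
    have : JEq (f : WithOne S) (a * f * a : S) :=
      hfull.jEq_mul_right ha (hfull.jEq_mul_left ha (.refl _))
    have h1 : (a * f * a : S) ∈ Set.range e := by rw [hrange]; exact this
    exact h1
  have : Nonempty (ReesMatrix P) := (hmid f (.refl _)).nonempty
  choose! m hm using hmid
  have hem : ∀ r, JEq (f : WithOne S) (e r) := fun r =>
    (hrange ▸ Set.mem_range_self r : e r ∈ {s : S | JEq (f : WithOne S) s})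
  have hiff : ∀ a : S, JLE (f : WithOne S) a → ∀ r,
      SameCls (f : WithOne S) a (e r) ↔ (m a).i = r.i ∧ (m a).l = r.l := by
    intro a ha r
    rw [hfull.sameCls_iff_mid ha (hem r), ← WithOne.coe_mul, ← WithOne.coe_mul, ← hm a ha]
    exact and_congr (hGreen _ _).1 (hGreen _ _).2
  have hPN : Q.IsPNHom i e
      (fun a => if JLE (f : WithOne S) a then (((m a).i, (m a).l) : I × L) else 0) := by
    refine ⟨fun a ha => ?_, fun a ha => ?_⟩
    · rw [Q.mem_annFree_union_layer_iff hfi hfull] at ha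
      refine ⟨(m a).i, (m a).l, if_pos ha, fun g hadj => ?_, fun g c' d' hne => ?_⟩
      · obtain ⟨t, ht, htbig, hta, hte, hn⟩ := (hM.rees_adj_iff _).1 hadj
        have her : e ⟨g, (m a).i, (m a).l⟩ ∈ Q.layer i := hlayer ▸ Set.mem_range_self _
        have htl : t ∈ Q.layer i := ⟨(Q.upper_isIdeal i).mem_of_jLE her.1 hte, ht⟩
        exact hn (hM.sameCls_congr hfull (Q.jEq_of_mem_layer hfi htl) WithOne.coe_ne_one
          WithOne.coe_ne_one ha (hem _).1 ((hiff a ha _).2 ⟨rfl, rfl⟩))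
      · refine (hM.rees_adj_iff _).2 ⟨f, hfi.2, hfbig, ha, (hem _).1, fun hs => hne ?_⟩
        obtain ⟨h1, h2⟩ := (hiff a ha _).1 hs
        exact Prod.ext h1.symm h2.symm
    · rw [Q.mem_annFree_union_layer_iff hfi hfull] at ha
      exact if_neg ha
  obtain ⟨a, ha, b, hb, hab⟩ := h G I L P e hinj hlayer _ hPN
  refine ⟨a, ha, b, hb, fun hs => hab ?_⟩
  have hk : ∀ a ∈ Q.layer k, JLE (f : WithOne S) a := fun a ha =>
    (hzf.2.trans hzc).trans (Q.jEq_of_mem_layer hc ha).1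
  have hza : ∀ a ∈ Q.layer k, JLE (z : WithOne S) a := fun a ha => hzf.1.trans (hk a ha)
  have hs' := hM.sameCls_congr hbig.1 hzf WithOne.coe_ne_one WithOne.coe_ne_one (hza a ha)
    (hza b hb) hs
  have h1 : SameCls (f : WithOne S) b (e (m b)) := (hiff b (hk b hb) _).2 ⟨rfl, rfl⟩
  obtain ⟨h2, h3⟩ := (hiff a (hk a ha) _).1 (hs'.trans h1)
  rw [if_pos (hk a ha), if_pos (hk b hb), h2, h3]

end Rees

/-! ### Propagating common upper bounds along walks -/

section Components

variable {S : Type u} [Semigroup S] [Finite S]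

/-- If z₁ and z₂ are J-equivalent, d works. Otherwise the layer of c is a connection, and (H1) gives
c' in it adjacent to d. By (H2), whichever of c', d is in the earlier layer lies above the layer of
the other, hence above both z₁ and z₃. -/
theorem exists_jLE_of_isMinBig {Q : PrincipalSeries S} (h1 : Q.H1) (h2 : Q.H2)
    (hM : IsPN (WithOne S)) {z₁ z₂ z₃ c d : S} (hz₁ : IsMinBig z₁) (hz₂ : IsMinBig z₂)
    (hc₁ : JLE (z₁ : WithOne S) c) (hc₂ : JLE (z₂ : WithOne S) c) (hd₂ : JLE (z₂ : WithOne S) d)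
    (hd₃ : JLE (z₃ : WithOne S) d) :
    ∃ t : S, JLE (z₁ : WithOne S) t ∧ JLE (z₃ : WithOne S) t := by
  by_cases h12 : JLE (z₂ : WithOne S) z₁
  · exact ⟨d, (hz₁.2 z₂ hz₂.1 h12).trans hd₂, hd₃⟩
  obtain ⟨i, hi⟩ := Q.exists_mem_layer z₁
  obtain ⟨j, hj⟩ := Q.exists_mem_layer z₂
  obtain ⟨k, hk⟩ := Q.exists_mem_layer c
  obtain ⟨l, hl⟩ := Q.exists_mem_layer d
  have hconn : Q.IsConnection k i j := by
    refine ⟨Q.isRoot_of_isMinBig hi hz₁ hM, Q.isRoot_of_isMinBig hj hz₂ hM, fun he => h12 ?_,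
      fun s hs => ⟨(Q.mem_stem_iff hi hz₁.1.1).2 (hc₁.trans (Q.jEq_of_mem_layer hk hs).1),
        (Q.mem_stem_iff hj hz₂.1.1).2 (hc₂.trans (Q.jEq_of_mem_layer hk hs).1)⟩⟩
    exact (Q.mem_stem_iff hj hz₂.1.1).1 (he ▸ (Q.mem_stem_iff hi hz₁.1.1).2 (.refl _))
  obtain ⟨a, ha, b, hb, hab⟩ := (h1 k i j hconn).2.exists_not_sameCls hM hj hz₂.1 hk hc₂
  -- Two elements of the layer determine different H-classes of z₂, so d cannot agree with both.
  obtain ⟨c', hc', hn⟩ : ∃ c' ∈ Q.layer k, ¬ SameCls (z₂ : WithOne S) c' d := by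
    by_contra! hall
    exact hab ((hall a ha).trans (hall b hb).symm)
  have hadj : (upperGraph S).Adj c' d :=
    hM.adj_iff.2 ⟨z₂, hz₂.1, hc₂.trans (Q.jEq_of_mem_layer hk hc').1, hd₂, hn⟩
  have hc'₁ := hc₁.trans (Q.jEq_of_mem_layer hk hc').1
  rcases lt_trichotomy k l with hlt | heq | hlt
  · obtain ⟨t, ht, htc⟩ :=
      Q.exists_mul_of_mem_annFree (h2 k l hlt ⟨c', hc', d, hl, hadj⟩ hc')
    exact ⟨c', hc'₁, (hd₃.trans (Q.jEq_of_mem_layer hl ht).1).trans htc⟩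
  · subst heq
    exact ⟨d, hc₁.trans (Q.jEq_of_mem_layer hk hl).1, hd₃⟩
  · obtain ⟨t, ht, htd⟩ :=
      Q.exists_mul_of_mem_annFree (h2 l k hlt ⟨d, hl, c', hc', hadj.symm⟩ hl)
    exact ⟨d, (hc₁.trans (Q.jEq_of_mem_layer hk ht).1).trans htd, hd₃⟩

/-- Each edge has a big class below both ends, and a minimal one may be chosen. The induction
hypothesis links this class to z₂, and the preceding lemma replaces it by z₁. -/
theorem exists_jLE_of_reachable {Q : PrincipalSeries S} (h1 : Q.H1) (h2 : Q.H2)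
    (hM : IsPN (WithOne S)) {x y : S} (h : (upperGraph S).Reachable x y) {z₁ z₂ : S}
    (hz₁ : IsMinBig z₁) (hx : JLE (z₁ : WithOne S) x) (hy : JLE (z₂ : WithOne S) y) :
    ∃ t : S, JLE (z₁ : WithOne S) t ∧ JLE (z₂ : WithOne S) t := by
  obtain ⟨p⟩ := h
  induction p generalizing z₁ with
  | nil => exact ⟨_, hx, hy⟩
  | cons hadj _ ih =>
    obtain ⟨z, hz, hzx, hzy, -⟩ := hM.adj_iff.1 hadj
    obtain ⟨z', hz', hle⟩ := exists_isMinBig hz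
    obtain ⟨t, ht, ht₂⟩ := ih hz' (hle.trans hzy) hy
    exact exists_jLE_of_isMinBig h1 h2 hM hz₁ hz' hx (hle.trans hzx) ht ht₂

end Components

end PseudoNilpotent

theorem mainTheorem10 {S : Type*} [Semigroup S] [Finite S]
    (hS : PseudoNilpotent.IsStrongPseudoNilpotent S)
    (x y : S) (hx : x ∉ PseudoNilpotent.isolatedSet S) (hy : y ∉ PseudoNilpotent.isolatedSet S) :
    (PseudoNilpotent.upperGraph S).connectedComponentMk x =
        (PseudoNilpotent.upperGraph S).connectedComponentMk y ↔
      ∃ z : S, x * z ∉ PseudoNilpotent.isolatedSet S ∧ z * y ∉ PseudoNilpotent.isolatedSet S := by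
  obtain ⟨hpn, Q, h1, h2⟩ := hS
  have hM := PseudoNilpotent.isPN_withOne hpn
  rw [SimpleGraph.ConnectedComponent.eq]
  constructor
  · intro h
    obtain ⟨z₁, hz₁, hx₁⟩ := hM.not_mem_isolatedSet_iff.1 hx
    obtain ⟨z₂, hz₂, hy₂⟩ := hM.not_mem_isolatedSet_iff.1 hy
    obtain ⟨t₁, ht₁, hle₁⟩ := PseudoNilpotent.exists_isMinBig hz₁
    obtain ⟨t, htt₁, htt₂⟩ :=
      PseudoNilpotent.exists_jLE_of_reachable h1 h2 hM h ht₁ (hle₁.trans hx₁) hy₂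
    -- Fullness keeps xt above t₁ and ty above z₂.
    exact ⟨t, hM.not_mem_isolatedSet_iff.2 ⟨t₁, ht₁.1, ht₁.1.1.jLE_mul (hle₁.trans hx₁) htt₁⟩,
      hM.not_mem_isolatedSet_iff.2 ⟨z₂, hz₂, hz₂.1.jLE_mul htt₂ hy₂⟩⟩
  · rintro ⟨z, hxz, hzy⟩
    obtain ⟨z₁, hz₁, h₁⟩ := hM.not_mem_isolatedSet_iff.1 hxz
    obtain ⟨z₂, hz₂, h₂⟩ := hM.not_mem_isolatedSet_iff.1 hzy
    rw [WithOne.coe_mul] at h₁ h₂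
    exact (hM.reachable_of_jLE hz₁ h₁.of_mul_left h₁.of_mul_right).trans
      (hM.reachable_of_jLE hz₂ h₂.of_mul_left h₂.of_mul_right)
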